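/- Let $G\rightrightarrows M$ be a Lie groupoid with source $s$, target $t$ and units $1_x$ ($gh$ is defined when $s(g)=t(h)$), where $M$ is a finite-dimensional smooth manifold (Hausdorff, second countable) and $G$ is a finite-dimensional smooth manifold (not necessarily Hausdorff). An $\mathbb{R}^\times$-valued 1-cochain is a smooth function $\psi\colon G\to\mathbb{R}^\times$; it is a cocycle if $\psi(gh)=\psi(g)\psi(h)$ for composable $g,h$, and the coboundary of $f\in C^\infty(M;\mathbb{R}^\times)$ is $(\delta f)(g)=f(s(g))/f(t(g))$. This gives $H^1(G;\mathbb{R}^\times)$. Let $A\to M$ be the Lie algebroid of $G$, described by left-invariant vector fields: $A_x=\ker(dt)_{1_x}\subset T_{1_x}G$, the anchor is $\rho=ds|_A$, and the bracket of sections is the Lie bracket of the corresponding left-invariant vector fields on $G$, restricted to the units. A Lie algebroid 1-cochain is $\theta\in\Gamma(A^*)$; it is a cocycle if $\rho(X)\theta(Y)-\rho(Y)\theta(X)-\theta([X,Y])=0$ for all $X,Y\in\Gamma(A)$, and the coboundary of $f\in C^\infty(M)$ is $X\mapsto\rho(X)f$. This gives $H^1(A)$. For $X\in\Gamma(A)$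 let $\bar X$ be the associated vector field along the units tangent to the $s$-fibers, that is, the one congruent to $X$ modulo the tangent spaces of the submanifold of units: $\bar X_x=X_x-d1(\rho(X_x))$, where $d1$ is the differential of $x\mapsto 1_x$. The van Est map sends a normalized 1-cochain $\psi$ ($\psi(1_x)=1$ for all $x$; all cocycles are normalized) to the section $V\psi$ of $A^*$ with $V\psi(X)=\bar X(\log\psi)$. Let $L\to M$ be a trivializable smooth real line bundle with a representation $\Delta$ of $G$: linear isomorphisms $\Delta_g\colon L_{s(g)}\to L_{t(g)}$ depending smoothly on $g$, with $\Delta_{gh}=\Delta_g\Delta_h$ for composable $g,h$. The induced representation $\nabla$ of $A$ on $L$ is given, for $a\in A_x$ and $\sigma\in\Gamma(L)$, by $$\nabla_a\sigma=\frac{d}{du}\Big|_{u=0}\Delta_{\gamma_u}\sigma(s(\gamma_u))\in L_x ,$$ where $\gamma_u$ is a smooth path in $t^{-1}(x)$ with $\gamma_0=1_x$ and $\dot\gamma_0=a$. **Theorem.** For every nonvanishing section $\sigma\in\Gamma(L)$: 1. there is a unique function $\phi_\sigma\in C^\infty(G;\mathbb{R}^\times)$ with $\Delta_g\sigma(s(g))=\phi_\sigma(g)\,\sigma(t(g))$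 for all $g\in G$, and it is a groupoid 1-cocycle; 2. there is a unique section $\theta_\sigma$ of $A^*$ with $\nabla_X\sigma=\theta_\sigma(X)\,\sigma$ for all $X\in\Gamma(A)$, and it is a (smooth) Lie algebroid 1-cocycle; 3. $V\phi_\sigma=\theta_\sigma$. Moreover, there is a unique group homomorphism $V_*\colon H^1(G;\mathbb{R}^\times)\to H^1(A)$ induced by $V$ on cocycles (in particular $V$ maps cocycles to cocycles). The classes $\Phi_L=[\phi_\sigma]\in H^1(G;\mathbb{R}^\times)$ and $\Theta_L=[\theta_\sigma]\in H^1(A)$ (the latter being the Evens–Lu–Weinstein characteristic class of $(L,\nabla)$) do not depend on the nonvanishing section $\sigma$, and $V_*\Phi_L=\Theta_L$. -/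

import Mathlib

open scoped Manifold ContDiff Bundle
open Bundle

noncomputable section

section VanEst

variable {EM : Type*} [NormedAddCommGroup EM] [NormedSpace ℝ EM]
  {M : Type*} [TopologicalSpace M] [ChartedSpace EM M]
  {EG : Type*} [NormedAddCommGroup EG] [NormedSpace ℝ EG]
  {G : Type*} [TopologicalSpace G] [ChartedSpace EG G]

variable (EM M EG G) in
/-- A Lie groupoid `G ⇉ M`. The product `mul g h` of two arrows is meaningful only if they are
composable, that is, if `s g = t h`; the value of `mul` at other pairs plays no role anywhere.
Since `s` and `t` are submersions of finite-dimensional manifolds, the set of composable pairs is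
an embedded submanifold of `G × G`, and smoothness of the product on it is `ContMDiffOn`. -/
structure LieGroupoid where
  /-- source -/
  s : C^∞⟮𝓘(ℝ, EG), G; 𝓘(ℝ, EM), M⟯
  /-- target -/
  t : C^∞⟮𝓘(ℝ, EG), G; 𝓘(ℝ, EM), M⟯
  /-- the unit arrow `1_x` -/
  one : C^∞⟮𝓘(ℝ, EM), M; 𝓘(ℝ, EG), G⟯
  /-- inversion -/
  inv : C^∞⟮𝓘(ℝ, EG), G; 𝓘(ℝ, EG), G⟯
  /-- multiplication of composable arrows -/
  mul : G → G → G
  s_submersion : ∀ g, Function.Surjective (mfderiv 𝓘(ℝ, EG) 𝓘(ℝ, EM) s g)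
  t_submersion : ∀ g, Function.Surjective (mfderiv 𝓘(ℝ, EG) 𝓘(ℝ, EM) t g)
  contMDiffOn_mul : ContMDiffOn (𝓘(ℝ, EG).prod 𝓘(ℝ, EG)) 𝓘(ℝ, EG) ∞
    (fun p : G × G => mul p.1 p.2) {p : G × G | s p.1 = t p.2}
  s_one : ∀ x, s (one x) = x
  t_one : ∀ x, t (one x) = x
  s_mul : ∀ g h, s g = t h → s (mul g h) = s h
  t_mul : ∀ g h, s g = t h → t (mul g h) = t g
  mul_assoc : ∀ g h k, s g = t h → s h = t k → mul (mul g h) k = mul g (mul h k)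
  one_mul : ∀ g, mul (one (t g)) g = g
  mul_one : ∀ g, mul g (one (s g)) = g
  s_inv : ∀ g, s (inv g) = t g
  t_inv : ∀ g, t (inv g) = s g
  inv_mul : ∀ g, mul (inv g) g = one (s g)
  mul_inv : ∀ g, mul g (inv g) = one (t g)

namespace LieGroupoid

variable (𝒢 : LieGroupoid EM M EG G)

/-! ### Groupoid cohomology in degree one with values in the multiplicative group `ℝˣ` -/

/-- Smooth groupoid `1`-cochains with values in `ℝˣ`, a group under pointwise multiplication. -/
abbrev Cochain (_𝒢 : LieGroupoid EM M EG G) := C^∞⟮𝓘(ℝ, EG), G; 𝓘(ℝ, ℝ), ℝˣ⟯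

/-- The group of `1`-cocycles: `φ (g h) = φ g * φ h` for composable `g, h`. -/
def cocycles : Subgroup 𝒢.Cochain where
  carrier := {φ | ∀ g h, 𝒢.s g = 𝒢.t h → φ (𝒢.mul g h) = φ g * φ h}
  mul_mem' := by
    intro φ ψ hφ hψ g h hgh
    simp only [ContMDiffMap.coe_mul, Pi.mul_apply, hφ g h hgh, hψ g h hgh]
    exact mul_mul_mul_comm _ _ _ _
  one_mem' := by
    intro g h _
    simp
  inv_mem' := by
    intro φ hφ g h hgh
    change (φ (𝒢.mul g h))⁻¹ = (φ g)⁻¹ * (φ h)⁻¹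
    rw [hφ g h hgh, _root_.mul_inv]

/-- The group of `1`-coboundaries: `(δ f) g = f (s g) / f (t g)` for a smooth `f : M → ℝˣ`. -/
def coboundaries : Subgroup 𝒢.Cochain where
  carrier := {φ | ∃ f : C^∞⟮𝓘(ℝ, EM), M; 𝓘(ℝ, ℝ), ℝˣ⟯, ∀ g, φ g = f (𝒢.s g) / f (𝒢.t g)}
  mul_mem' := by
    rintro φ ψ ⟨f, hf⟩ ⟨f', hf'⟩
    refine ⟨f * f', fun g => ?_⟩
    simp only [ContMDiffMap.coe_mul, Pi.mul_apply, hf g, hf' g]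
    exact div_mul_div_comm _ _ _ _
  one_mem' := ⟨1, fun g => by simp⟩
  inv_mem' := by
    rintro φ ⟨f, hf⟩
    refine ⟨f⁻¹, fun g => ?_⟩
    change (φ g)⁻¹ = (f (𝒢.s g))⁻¹ / (f (𝒢.t g))⁻¹
    rw [hf g, inv_div_inv, inv_div]

/-- `H¹(G; ℝˣ)`. -/
abbrev H1 := 𝒢.cocycles ⧸ 𝒢.coboundaries.subgroupOf 𝒢.cocycles

/-- The class of a cocycle in `H¹(G; ℝˣ)`. -/
def H1.mk (φ : 𝒢.cocycles) : 𝒢.H1 := QuotientGroup.mk φ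

/-! ### The Lie algebroid of `G`, built from left-invariant vector fields -/

/-- The fibre `A_x` of the Lie algebroid: the vectors at the unit `1_x` tangent to the `t`-fibre. -/
abbrev A (x : M) : Submodule ℝ (TangentSpace 𝓘(ℝ, EG) (𝒢.one x)) :=
  LinearMap.ker (mfderiv 𝓘(ℝ, EG) 𝓘(ℝ, EM) 𝒢.t (𝒢.one x)).toLinearMap

/-- The differential of the source map, as a map `T_{1_x} G → T_x M`. -/
def dsUnit (x : M) : TangentSpace 𝓘(ℝ, EG) (𝒢.one x) →ₗ[ℝ] TangentSpace 𝓘(ℝ, EM) x :=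
  (mfderiv 𝓘(ℝ, EG) 𝓘(ℝ, EM) 𝒢.s (𝒢.one x)).toLinearMap

/-- The differential of the target map, as a map `T_{1_x} G → T_x M`. -/
def dtUnit (x : M) : TangentSpace 𝓘(ℝ, EG) (𝒢.one x) →ₗ[ℝ] TangentSpace 𝓘(ℝ, EM) x :=
  (mfderiv 𝓘(ℝ, EG) 𝓘(ℝ, EM) 𝒢.t (𝒢.one x)).toLinearMap

/-- The differential of the unit map, `T_x M → T_{1_x} G`. -/
def dOne (x : M) : TangentSpace 𝓘(ℝ, EM) x →ₗ[ℝ] TangentSpace 𝓘(ℝ, EG) (𝒢.one x) :=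
  (mfderiv 𝓘(ℝ, EM) 𝓘(ℝ, EG) 𝒢.one x).toLinearMap

/-- The anchor `ρ : A_x → T_x M`, the restriction of the differential of the source map. -/
def anchor (x : M) : 𝒢.A x →ₗ[ℝ] TangentSpace 𝓘(ℝ, EM) x :=
  𝒢.dsUnit x ∘ₗ (𝒢.A x).subtype

theorem dtUnit_dOne (x : M) (v : TangentSpace 𝓘(ℝ, EM) x) : 𝒢.dtUnit x (𝒢.dOne x v) = v := by
  have h1 : MDifferentiableAt 𝓘(ℝ, EG) 𝓘(ℝ, EM) 𝒢.t (𝒢.one x) :=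
    𝒢.t.contMDiff.mdifferentiableAt (by simp)
  have h2 : MDifferentiableAt 𝓘(ℝ, EM) 𝓘(ℝ, EG) 𝒢.one x :=
    𝒢.one.contMDiff.mdifferentiableAt (by simp)
  have h3 := mfderiv_comp x h1 h2
  have h4 : (𝒢.t ∘ 𝒢.one : M → M) = id := funext 𝒢.t_one
  rw [h4, mfderiv_id] at h3
  exact (DFunLike.congr_fun h3 v).symm

/-- The projection of `T_{1_x} G = T_x M ⊕ A_x` onto `A_x` along the tangent space of the
submanifold of units: `v ↦ v - d1 (dt v)`. -/
def projA (x : M) : TangentSpace 𝓘(ℝ, EG) (𝒢.one x) →ₗ[ℝ] 𝒢.A x :=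
  LinearMap.codRestrict (𝒢.A x) (LinearMap.id - 𝒢.dOne x ∘ₗ 𝒢.dtUnit x) (by
    intro v
    change 𝒢.dtUnit x (v - 𝒢.dOne x (𝒢.dtUnit x v)) = 0
    rw [map_sub, dtUnit_dOne, sub_self])

/-- Families of linear functionals on the fibres of `A`, i.e. (not necessarily smooth) sections of
the dual bundle `A*`. -/
def Form := ∀ x, 𝒢.A x →ₗ[ℝ] ℝ

instance : AddCommGroup 𝒢.Form := inferInstanceAs (AddCommGroup (∀ x, 𝒢.A x →ₗ[ℝ] ℝ))

instance : Module ℝ 𝒢.Form := inferInstanceAs (Module ℝ (∀ x, 𝒢.A x →ₗ[ℝ] ℝ))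

/-! ### The van Est map in degree one -/

/-- The vector `X̄` at `1_x` tangent to the `s`-fibre that is associated with `a ∈ A_x`: the one
congruent to `a` modulo the tangent space of the submanifold of units, `a - d1 (ρ a)`. -/
def sTangent (x : M) : 𝒢.A x →ₗ[ℝ] TangentSpace 𝓘(ℝ, EG) (𝒢.one x) :=
  (𝒢.A x).subtype - 𝒢.dOne x ∘ₗ 𝒢.anchor x

/-- The van Est map on `1`-cochains, `V ψ (X) = X̄ (log ψ)`. It is meant for cochains that are
normalized (`ψ 1_x = 1`, which all cocycles satisfy), so that `ψ > 0` near the units. -/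
def vanEst (ψ : 𝒢.Cochain) : 𝒢.Form := fun x =>
  (mfderiv 𝓘(ℝ, EG) 𝓘(ℝ, ℝ) (fun g => Real.log (ψ g : ℝ)) (𝒢.one x)).toLinearMap ∘ₗ
    𝒢.sTangent x

variable [IsManifold 𝓘(ℝ, EG) ∞ G]

/-- The module `Γ(A)` of smooth sections of `A`; smoothness is that of a vector field on `G` along
the unit map. -/
structure AlgSection where
  /-- the value at a point -/
  toFun : ∀ x, 𝒢.A x
  contMDiff_toFun : ContMDiff 𝓘(ℝ, EM) 𝓘(ℝ, EG).tangent ∞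
    (fun x => (⟨𝒢.one x, toFun x⟩ : TangentBundle 𝓘(ℝ, EG) G))

instance : CoeFun 𝒢.AlgSection (fun _ => ∀ x, 𝒢.A x) := ⟨AlgSection.toFun⟩

variable {𝒢} in
/-- The left-invariant vector field on `G` with value `X x` at each unit `1_x`: its value at `g` is
the image of `X (s g)` under the differential at `1_{s g}` of the left translation
`h ↦ g h`, `t⁻¹(s g) → t⁻¹(t g)`. -/
def AlgSection.leftInvariant (X : 𝒢.AlgSection) (g : G) : TangentSpace 𝓘(ℝ, EG) g :=
  mfderivWithin 𝓘(ℝ, EG) 𝓘(ℝ, EG) (fun h => 𝒢.mul g h) {h | 𝒢.t h = 𝒢.s g}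
    (𝒢.one (𝒢.s g)) (X (𝒢.s g) : TangentSpace 𝓘(ℝ, EG) (𝒢.one (𝒢.s g)))

variable {𝒢} in
/-- The Lie bracket of two sections of `A`: the restriction to the units of the Lie bracket of the
corresponding left-invariant vector fields. This restriction is tangent to the `t`-fibres, so that
`projA` leaves it unchanged and only records that it belongs to `A`. -/
def AlgSection.bracket (X Y : 𝒢.AlgSection) (x : M) : 𝒢.A x :=
  𝒢.projA x (VectorField.mlieBracket 𝓘(ℝ, EG) X.leftInvariant Y.leftInvariant (𝒢.one x))

/-! ### Lie algebroid cohomology in degree one -/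

variable {𝒢} in
/-- `θ` is a smooth section of `A*`, i.e. a Lie algebroid `1`-cochain: `θ(X)` is a smooth function
for every smooth section `X` of `A`. -/
def IsSmoothForm (θ : 𝒢.Form) : Prop :=
  ∀ X : 𝒢.AlgSection, ContMDiff 𝓘(ℝ, EM) 𝓘(ℝ, ℝ) ∞ (fun x => θ x (X x))

/-- The derivative of the function `f` on `M` at `x` in the direction `ρ(a)`. -/
def anchorDeriv (f : M → ℝ) (x : M) (a : 𝒢.A x) : ℝ :=
  mfderiv 𝓘(ℝ, EM) 𝓘(ℝ, ℝ) f x (𝒢.anchor x a)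

/-- Lie algebroid `1`-cocycles: the smooth sections `θ` of `A*` with
`ρ(X) (θ(Y)) - ρ(Y) (θ(X)) - θ([X, Y]) = 0` for all sections `X, Y` of `A`. -/
def algCocycles : Submodule ℝ 𝒢.Form where
  carrier := {θ | IsSmoothForm θ ∧ ∀ (X Y : 𝒢.AlgSection) (x : M),
    𝒢.anchorDeriv (fun y => θ y (Y y)) x (X x) - 𝒢.anchorDeriv (fun y => θ y (X y)) x (Y x)
      - θ x (X.bracket Y x) = 0}
  add_mem' := by
    rintro θ η ⟨sθ, hθ⟩ ⟨sη, hη⟩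
    refine ⟨fun X => (sθ X).add (sη X), fun X Y x => ?_⟩
    have key : ∀ Z W : 𝒢.AlgSection, 𝒢.anchorDeriv (fun y => (θ + η) y (Z y)) x (W x) =
        𝒢.anchorDeriv (fun y => θ y (Z y)) x (W x)
          + 𝒢.anchorDeriv (fun y => η y (Z y)) x (W x) := by
      intro Z W
      have h := ((sθ Z).mdifferentiableAt (by simp) (x := x)).hasMFDerivAt.add
        ((sη Z).mdifferentiableAt (by simp) (x := x)).hasMFDerivAt
      exact DFunLike.congr_fun h.mfderiv (𝒢.anchor x (W x))
    have h1 := hθ X Y x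
    have h2 := hη X Y x
    have h3 : (θ + η) x (X.bracket Y x) = θ x (X.bracket Y x) + η x (X.bracket Y x) := rfl
    rw [key, key, h3]
    linarith
  zero_mem' := by
    refine ⟨fun X => contMDiff_const, fun X Y x => ?_⟩
    have key : ∀ Z W : 𝒢.AlgSection,
        𝒢.anchorDeriv (fun y => (0 : 𝒢.Form) y (Z y)) x (W x) = 0 := by
      intro Z W
      have h := hasMFDerivAt_const (I := 𝓘(ℝ, EM)) (I' := 𝓘(ℝ, ℝ)) (0 : ℝ) x
      exact DFunLike.congr_fun h.mfderiv (𝒢.anchor x (W x))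
    rw [key, key, sub_zero, zero_sub]
    exact neg_zero
  smul_mem' := by
    rintro c θ ⟨sθ, hθ⟩
    refine ⟨fun X => (contMDiff_const (c := c)).mul (sθ X), fun X Y x => ?_⟩
    have key : ∀ Z W : 𝒢.AlgSection, 𝒢.anchorDeriv (fun y => (c • θ) y (Z y)) x (W x) =
        c * 𝒢.anchorDeriv (fun y => θ y (Z y)) x (W x) := by
      intro Z W
      have h := ((sθ Z).mdifferentiableAt (by simp) (x := x)).hasMFDerivAt.const_smul c
      exact DFunLike.congr_fun h.mfderiv (𝒢.anchor x (W x))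
    have h1 := hθ X Y x
    have h3 : (c • θ) x (X.bracket Y x) = c * θ x (X.bracket Y x) := rfl
    rw [key, key, h3, ← mul_sub, ← mul_sub, h1, mul_zero]

/-- Lie algebroid `1`-coboundaries: `(d f)(a) = ρ(a) f` for a smooth function `f` on `M`. -/
def algCoboundaries : Submodule ℝ 𝒢.Form where
  carrier := {θ | ∃ f : C^∞⟮𝓘(ℝ, EM), M; 𝓘(ℝ, ℝ), ℝ⟯, ∀ x a, θ x a = 𝒢.anchorDeriv f x a}
  add_mem' := by
    rintro θ η ⟨f, hf⟩ ⟨f', hf'⟩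
    refine ⟨f + f', fun x a => ?_⟩
    have h := (f.contMDiff.mdifferentiableAt (by simp) (x := x)).hasMFDerivAt.add
      (f'.contMDiff.mdifferentiableAt (by simp) (x := x)).hasMFDerivAt
    have h' : 𝒢.anchorDeriv (f + f') x a = 𝒢.anchorDeriv f x a + 𝒢.anchorDeriv f' x a :=
      DFunLike.congr_fun h.mfderiv (𝒢.anchor x a)
    change θ x a + η x a = 𝒢.anchorDeriv (f + f') x a
    rw [h', hf, hf']
  zero_mem' := by
    refine ⟨0, fun x a => ?_⟩
    have h := hasMFDerivAt_const (I := 𝓘(ℝ, EM)) (I' := 𝓘(ℝ, ℝ)) (0 : ℝ) x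
    exact (DFunLike.congr_fun h.mfderiv (𝒢.anchor x a)).symm
  smul_mem' := by
    rintro c θ ⟨f, hf⟩
    refine ⟨c • f, fun x a => ?_⟩
    have h := (f.contMDiff.mdifferentiableAt (by simp) (x := x)).hasMFDerivAt.const_smul c
    have h' : 𝒢.anchorDeriv (c • f) x a = c * 𝒢.anchorDeriv f x a :=
      DFunLike.congr_fun h.mfderiv (𝒢.anchor x a)
    change c * θ x a = 𝒢.anchorDeriv (c • f) x a
    rw [h', hf]

/-- `H¹(A)`. -/
abbrev AlgH1 := 𝒢.algCocycles ⧸ 𝒢.algCoboundaries.submoduleOf 𝒢.algCocycles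

/-- The class of a cocycle in `H¹(A)`. -/
def AlgH1.mk (θ : 𝒢.algCocycles) : 𝒢.AlgH1 := Submodule.Quotient.mk θ

/-- A homomorphism `H¹(G; ℝˣ) → H¹(A)` (multiplicative to additive) is induced by the van Est map
if, for every cocycle `φ`, the cochain `V φ` is smooth and closed and its class is the image of the
class of `φ`. -/
def IsInducedByVanEst (F : Additive 𝒢.H1 →+ 𝒢.AlgH1) : Prop :=
  ∀ φ : 𝒢.cocycles, ∃ θ : 𝒢.algCocycles, θ.1 = 𝒢.vanEst φ.1 ∧
    F (Additive.ofMul (H1.mk 𝒢 φ)) = AlgH1.mk 𝒢 θ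

end LieGroupoid

/-! ### Representations on line bundles -/

variable (L : M → Type*) [∀ x, AddCommGroup (L x)] [∀ x, Module ℝ (L x)]
  [∀ x, TopologicalSpace (L x)] [TopologicalSpace (TotalSpace ℝ L)] [FiberBundle ℝ L]

/-- The identification of the fibres of `L` at two equal points. -/
def fiberCast {x y : M} (h : x = y) : L x ≃ₗ[ℝ] L y := h ▸ LinearEquiv.refl ℝ (L x)

/-- A representation of a Lie groupoid on a line bundle `L`: linear isomorphisms
`Δ_g : L_{s g} → L_{t g}`, depending smoothly on `g` (the induced map from the total space of the
pullback `s^* L` to that of `L` is smooth), with `Δ_{g h} = Δ_g Δ_h` for composable `g, h`. -/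
structure LineBundleRep (𝒢 : LieGroupoid EM M EG G) where
  /-- the isomorphism `Δ_g` -/
  act : ∀ g, L (𝒢.s g) ≃ₗ[ℝ] L (𝒢.t g)
  contMDiff_act : ContMDiff (𝓘(ℝ, EG).prod 𝓘(ℝ, ℝ)) (𝓘(ℝ, EM).prod 𝓘(ℝ, ℝ)) ∞
    (fun p : TotalSpace ℝ (𝒢.s *ᵖ L) => (⟨𝒢.t p.1, act p.1 p.2⟩ : TotalSpace ℝ L))
  act_mul : ∀ (g h : G) (hgh : 𝒢.s g = 𝒢.t h) (v : L (𝒢.s h)),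
    act (𝒢.mul g h) (fiberCast L (𝒢.s_mul g h hgh).symm v) =
      fiberCast L (𝒢.t_mul g h hgh).symm (act g (fiberCast L hgh.symm (act h v)))

namespace LineBundleRep

variable {L} {𝒢 : LieGroupoid EM M EG G} (Δ : LineBundleRep L 𝒢)

/-- `φ` is the characteristic function of `(L, Δ, σ)`: `Δ_g (σ (s g)) = φ g • σ (t g)`. -/
def IsCharFun (σ : Cₛ^∞⟮𝓘(ℝ, EM); ℝ, L⟯) (φ : 𝒢.Cochain) : Prop :=
  ∀ g, Δ.act g (σ (𝒢.s g)) = (φ g : ℝ) • σ (𝒢.t g)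

/-- The representation `∇` of the Lie algebroid on `L` induced by `Δ`: for `a ∈ A_x` and a section
`σ`, `∇_a σ` is the derivative at `1_x` in the direction `a` of the `L_x`-valued function
`g ↦ Δ_g (σ (s g))` on the `t`-fibre `t⁻¹(x)`. The derivative is taken in the fibre coordinate of
a local trivialization of `L` around `x`. -/
def nabla (σ : Cₛ^∞⟮𝓘(ℝ, EM); ℝ, L⟯) (x : M) (a : 𝒢.A x) : L x :=
  (trivializationAt ℝ L x).symm x
    (mfderiv 𝓘(ℝ, EG) 𝓘(ℝ, ℝ)
      (fun g => (trivializationAt ℝ L x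
        (⟨𝒢.t g, Δ.act g (σ (𝒢.s g))⟩ : TotalSpace ℝ L)).2) (𝒢.one x)
      (a : TangentSpace 𝓘(ℝ, EG) (𝒢.one x)) : ℝ)

variable [IsManifold 𝓘(ℝ, EG) ∞ G]

/-- `θ` is the Lie algebroid `1`-form `θ_σ` of `(L, ∇, σ)`: `∇_a σ = θ(a) • σ`. -/
def IsCharForm (σ : Cₛ^∞⟮𝓘(ℝ, EM); ℝ, L⟯) (θ : 𝒢.Form) : Prop :=
  ∀ (x : M) (a : 𝒢.A x), Δ.nabla σ x a = θ x a • σ x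

/-- `Φ` is the characteristic class of `(L, Δ)`: the class of the characteristic function of every
nonvanishing section. -/
def IsCharClass (Φ : 𝒢.H1) : Prop :=
  ∀ σ : Cₛ^∞⟮𝓘(ℝ, EM); ℝ, L⟯, (∀ x, σ x ≠ 0) →
    ∃ φ : 𝒢.cocycles, Δ.IsCharFun σ φ.1 ∧ LieGroupoid.H1.mk 𝒢 φ = Φ

/-- `Θ` is the characteristic class of the Lie algebroid representation `(L, ∇)`: the class of the
`1`-cocycle of every nonvanishing section. -/
def IsAlgCharClass (Θ : 𝒢.AlgH1) : Prop :=
  ∀ σ : Cₛ^∞⟮𝓘(ℝ, EM); ℝ, L⟯, (∀ x, σ x ≠ 0) →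
    ∃ θ : 𝒢.algCocycles, Δ.IsCharForm σ θ.1 ∧ LieGroupoid.AlgH1.mk 𝒢 θ = Θ

end LineBundleRep
end VanEst
end

/-! For a cocycle φ the function log|φ| is additive on products and vanishes on the units. Vanishing
on the units makes X and X̄ interchangeable, so Vφ is the derivative of log|φ| on A
(`vanEst_apply_of_mem_cocycles`). Additivity makes the derivative of log|φ| along the left-invariant
field of X equal to Vφ(X)∘s near the units (`eventually_dirDeriv_leftInvariant`). A Lie bracket acts
on functions as a commutator (`mfderiv_mlieBracket_apply`); applied to log|φ| at a unit, this is the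
cocycle equation for Vφ. For a coboundary, log|δf| = log|f|∘s - log|f|∘t has derivative ρ(·)log|f|
on A = ker dt. Hence V descends to cohomology.

The analytic difficulty is that left translations live on t-fibres only. The normal form of a
submersion parametrizes these fibres smoothly (`exists_local_leftTranslation`).

For a line bundle, φ_σ is the ratio of two nonvanishing sections along t. In a trivialization Δ_g
σ(s g) has coordinate φ_σ(g) k(t g), where k is the coordinate of σ. Along a t-fibre k∘t is
constant, and φ_σ is 1 at the unit, so ∇σ = (Vφ_σ)σ (`IsCharFun.nabla_eq`). Thus θ_σ = Vφ_σ inherits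
smoothness and closedness. Since φ_{fσ} = φ_σ δf, the class of φ_σ is independent of σ, and with it
that of θ_σ. -/

noncomputable section

/-! ### Submersions, Lie brackets as commutators, and tangent maps -/

section ManifoldPreliminaries

open Filter Topology

variable {E : Type*} [NormedAddCommGroup E] [NormedSpace ℝ E]
  {N : Type*} [TopologicalSpace N] [ChartedSpace E N]
  {E' : Type*} [NormedAddCommGroup E'] [NormedSpace ℝ E']
  {P : Type*} [TopologicalSpace P] [ChartedSpace E' P]
  {E'' : Type*} [NormedAddCommGroup E''] [NormedSpace ℝ E'']
  {Q : Type*} [TopologicalSpace Q] [ChartedSpace E'' Q]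

/-- The derivative of a real-valued function on a manifold in the direction of a tangent vector. -/
def dirDeriv (f : N → ℝ) (x : N) (v : TangentSpace 𝓘(ℝ, E) x) : ℝ :=
  mfderiv 𝓘(ℝ, E) 𝓘(ℝ, ℝ) f x v

/-- For order ∞ the neighbourhood may shrink with the order of differentiability, so the proof
descends to order 1, where the property is open. -/
theorem ContMDiffAt.eventually_mdifferentiableAt {H H' F F' M₁ M₂ : Type*} [NormedAddCommGroup F]
    [NormedSpace ℝ F] [NormedAddCommGroup F'] [NormedSpace ℝ F'] [TopologicalSpace H]
    [TopologicalSpace H'] [TopologicalSpace M₁] [TopologicalSpace M₂] [ChartedSpace H M₁]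
    [ChartedSpace H' M₂] {I : ModelWithCorners ℝ F H} {I' : ModelWithCorners ℝ F' H'}
    [IsManifold I ∞ M₁] [IsManifold I' ∞ M₂] {f : M₁ → M₂} {x : M₁}
    (hf : ContMDiffAt I I' ∞ f x) : ∀ᶠ y in 𝓝 x, MDifferentiableAt I I' f y := by
  have h1 : ContMDiffAt I I' 1 f x := hf.of_le (by simp)
  have : IsManifold I 1 M₁ := IsManifold.of_le (n := ∞) (by simp)
  have : IsManifold I' 1 M₂ := IsManifold.of_le (n := ∞) (by simp)
  exact ((contMDiffAt_iff_contMDiffAt_nhds (by simp)).1 h1).mono fun y hy =>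
    hy.mdifferentiableAt one_ne_zero

/-- Local normal form of a submersion `t : N → P` near `p`: there are a local coordinate `κ` on
`N` and a local map `q` with `q (t h, κ h) = h` and `t (q (y, e)) = y`. -/
theorem exists_local_section_of_submersion [FiniteDimensional ℝ E] [FiniteDimensional ℝ E']
    [IsManifold 𝓘(ℝ, E) ∞ N] [IsManifold 𝓘(ℝ, E') ∞ P] {t : N → P} {p : N}
    (ht : ContMDiffAt 𝓘(ℝ, E) 𝓘(ℝ, E') ∞ t p)
    (hsurj : Function.Surjective (mfderiv 𝓘(ℝ, E) 𝓘(ℝ, E') t p)) :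
    ∃ (κ : N → E) (q : P × E → N),
      ContMDiffAt 𝓘(ℝ, E) 𝓘(ℝ, E) ∞ κ p ∧
      ContMDiffAt (𝓘(ℝ, E').prod 𝓘(ℝ, E)) 𝓘(ℝ, E) ∞ q (t p, κ p) ∧
      (∀ᶠ h in 𝓝 p, q (t h, κ h) = h) ∧
      ∀ᶠ z in 𝓝 (t p, κ p), t (q z) = z.1 := by
  set σ := extChartAt 𝓘(ℝ, E') (t p) with hσ
  set ψ := extChartAt 𝓘(ℝ, E) p with hψ
  set τ : E → E' := σ ∘ t ∘ ψ.symm with hτ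
  have hτs : ContDiffAt ℝ ∞ τ (ψ p) := by
    have := (contMDiffAt_iff.1 ht).2
    simpa only [modelWithCornersSelf_coe, Set.range_id, contDiffWithinAt_univ] using this
  obtain ⟨A, hA, hτd⟩ : ∃ A : E →L[ℝ] E', Function.Surjective A ∧ HasFDerivAt τ A (ψ p) := by
    refine ⟨fderiv ℝ τ (ψ p), ?_, (hτs.differentiableAt (by simp)).hasFDerivAt⟩
    have h := (ht.mdifferentiableAt (by simp)).mfderiv
    rw [h] at hsurj
    simp only [modelWithCornersSelf_coe, Set.range_id, fderivWithin_univ] at hsurj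
    exact hsurj
  obtain ⟨R, hR⟩ : ∃ R : E' →L[ℝ] E, ∀ y, A (R y) = y := by
    obtain ⟨R, hR⟩ := A.toLinearMap.exists_rightInverse_of_surjective (LinearMap.range_eq_top.2 hA)
    exact ⟨LinearMap.toContinuousLinearMap R, fun y => LinearMap.congr_fun hR y⟩
  -- `τ` is `t` in charts, with differential `A` split by `R`. The correction `v - R (A v)` makes
  -- the differential of `Ψ` the identity, while still `A ∘ Ψ = τ`; so `Ψ` straightens `t` to the
  -- linear map `A`.
  set Ψ : E → E := fun v => R (τ v) + (v - R (A v)) with hΨ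
  have hΨs : ContDiffAt ℝ ∞ Ψ (ψ p) :=
    (R.contDiff.contDiffAt.comp _ hτs).add
      (contDiffAt_id.sub (R.contDiff.comp A.contDiff).contDiffAt)
  have hΨd : HasFDerivAt Ψ ((ContinuousLinearEquiv.refl ℝ E : E ≃L[ℝ] E) : E →L[ℝ] E) (ψ p) := by
    have h1 := (R.hasFDerivAt.comp (ψ p) hτd).add
      ((hasFDerivAt_id (𝕜 := ℝ) (ψ p)).sub ((R.comp A).hasFDerivAt (x := ψ p)))
    convert! h1 using 1
    ext v
    simp
  have hAΨ : ∀ v, A (Ψ v) = τ v := fun v => by simp [hΨ, hR]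
  set Φ := hΨs.toOpenPartialHomeomorph Ψ hΨd (by simp) with hΦ
  have hΦc : ∀ v, Φ v = Ψ v := fun v => rfl
  have hp : ψ p ∈ Φ.source := hΨs.mem_toOpenPartialHomeomorph_source hΨd (by simp)
  have hp' : Ψ (ψ p) ∈ Φ.target := Φ.map_source hp
  have hsymm : Φ.symm (Ψ (ψ p)) = ψ p := Φ.left_inv hp
  have hΦs : ContDiffAt ℝ ∞ Φ.symm (Ψ (ψ p)) := hΨs.to_localInverse hΨd (by simp)
  have hψs : ContMDiffAt 𝓘(ℝ, E) 𝓘(ℝ, E) ∞ ψ p := contMDiffAt_extChartAt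
  have hψi : ContMDiffAt 𝓘(ℝ, E) 𝓘(ℝ, E) ∞ ψ.symm (ψ p) :=
    (contMDiffOn_extChartAt_symm p).contMDiffAt (extChartAt_target_mem_nhds p)
  have hσs : ContMDiffAt 𝓘(ℝ, E') 𝓘(ℝ, E') ∞ σ (t p) := contMDiffAt_extChartAt
  -- A shift along the image of `R` that forces `A (c z) = σ z.1`. It leaves `z.2` fixed when `A z.2
  -- = σ z.1` already, which gives the inverse property of `q`.
  set c : P × E → E := fun z => z.2 + R (σ z.1 - A z.2) with hc
  have hcp : c (t p, Ψ (ψ p)) = Ψ (ψ p) := by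
    have : τ (ψ p) = σ (t p) := by simp [hτ, hψ]
    simp [hc, hAΨ, this]
  have hcs : ContMDiffAt (𝓘(ℝ, E').prod 𝓘(ℝ, E)) 𝓘(ℝ, E) ∞ c (t p, Ψ (ψ p)) := by
    have h1 : ContMDiffAt (𝓘(ℝ, E').prod 𝓘(ℝ, E)) 𝓘(ℝ, E') ∞ (fun z : P × E => σ z.1)
        (t p, Ψ (ψ p)) := ContMDiffAt.comp (t p, Ψ (ψ p)) hσs contMDiffAt_fst
    have h2 : ContMDiffAt (𝓘(ℝ, E').prod 𝓘(ℝ, E)) 𝓘(ℝ, E) ∞ (fun z : P × E => z.2)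
        (t p, Ψ (ψ p)) := contMDiffAt_snd
    exact h2.add (R.contMDiff.contMDiffAt.comp _
      (h1.sub (A.contMDiff.contMDiffAt.comp _ h2)))
  have hAc : ∀ z, A (c z) = σ z.1 := fun z => by simp [hc, hR]
  have hw : ContMDiffAt 𝓘(ℝ, E) 𝓘(ℝ, E) ∞ (ψ.symm ∘ Φ.symm) (Ψ (ψ p)) :=
    ContMDiffAt.comp _ (by rw [hsymm]; exact hψi) hΦs.contMDiffAt
  have hq : ContMDiffAt (𝓘(ℝ, E').prod 𝓘(ℝ, E)) 𝓘(ℝ, E) ∞ (fun z => ψ.symm (Φ.symm (c z)))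
      (t p, Ψ (ψ p)) :=
    ContMDiffAt.comp (g := ψ.symm ∘ Φ.symm) (f := c) (t p, Ψ (ψ p)) (by rw [hcp]; exact hw) hcs
  have hqp : ψ.symm (Φ.symm (c (t p, Ψ (ψ p)))) = p := by
    rw [hcp, hsymm]; exact extChartAt_to_inv p
  refine ⟨fun h => Ψ (ψ h), fun z => ψ.symm (Φ.symm (c z)),
    hΨs.contMDiffAt.comp _ hψs, hq, ?_, ?_⟩
  · have e1 : ∀ᶠ h in 𝓝 p, h ∈ ψ.source := extChartAt_source_mem_nhds p
    have e2 : ∀ᶠ h in 𝓝 p, ψ h ∈ Φ.source :=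
      (continuousAt_extChartAt p).eventually_mem (Φ.open_source.mem_nhds hp)
    filter_upwards [e1, e2] with h h1 h2
    have h3 : τ (ψ h) = σ (t h) := by simp only [hτ, Function.comp, ψ.left_inv h1]
    have h4 : c (t h, Ψ (ψ h)) = Ψ (ψ h) := by simp [hc, hAΨ, h3]
    rw [h4, ← hΦc, Φ.left_inv h2, ψ.left_inv h1]
  · have e1 : ∀ᶠ z in 𝓝 (t p, Ψ (ψ p)), c z ∈ Φ.target :=
      hcs.continuousAt.eventually_mem (by rw [hcp]; exact Φ.open_target.mem_nhds hp')
    have e2 : ∀ᶠ z : P × E in 𝓝 (t p, Ψ (ψ p)), z.1 ∈ σ.source :=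
      continuousAt_fst.eventually_mem (extChartAt_source_mem_nhds (t p))
    have e3 : ∀ᶠ z in 𝓝 (t p, Ψ (ψ p)), t (ψ.symm (Φ.symm (c z))) ∈ σ.source := by
      have : ContinuousAt (fun z => t (ψ.symm (Φ.symm (c z)))) (t p, Ψ (ψ p)) :=
        ContinuousAt.comp (g := t) (by rw [hqp]; exact ht.continuousAt) hq.continuousAt
      refine this.eventually_mem ?_
      rw [hqp]
      exact extChartAt_source_mem_nhds (t p)
    filter_upwards [e1, e2, e3] with z h1 h2 h3
    refine σ.injOn h3 h2 ?_
    have : τ (Φ.symm (c z)) = σ z.1 := by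
      rw [← hAΨ, ← hΦc, Φ.right_inv h1, hAc]
    exact this

/-- The partial derivative of a smooth family of maps, applied to a smooth vector field along a
map, is smooth. -/
theorem contMDiffAt_mfderiv_apply_section [IsManifold 𝓘(ℝ, E) ∞ N] [IsManifold 𝓘(ℝ, E') ∞ P]
    [IsManifold 𝓘(ℝ, E'') ∞ Q] {F : N → P → Q} {g : N → P} {n₀ : N}
    (hF : ContMDiffAt (𝓘(ℝ, E).prod 𝓘(ℝ, E')) 𝓘(ℝ, E'') ∞ (Function.uncurry F) (n₀, g n₀))
    {v : ∀ n, TangentSpace 𝓘(ℝ, E') (g n)}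
    (hv : ContMDiffAt 𝓘(ℝ, E) 𝓘(ℝ, E').tangent ∞
      (fun n => (⟨g n, v n⟩ : TangentBundle 𝓘(ℝ, E') P)) n₀) :
    ContMDiffAt 𝓘(ℝ, E) 𝓘(ℝ, E'').tangent ∞
      (fun n => (⟨F n (g n), mfderiv 𝓘(ℝ, E') 𝓘(ℝ, E'') (F n) (g n) (v n)⟩ :
        TangentBundle 𝓘(ℝ, E'') Q)) n₀ := by
  have hg : ContMDiffAt 𝓘(ℝ, E) 𝓘(ℝ, E') ∞ g n₀ := (contMDiffAt_totalSpace.1 hv).1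
  have h1 := ContMDiffAt.mfderiv F g hF hg (m := ∞) (by simp)
  have h2 : ContMDiffAt 𝓘(ℝ, E) 𝓘(ℝ, E'') ∞ (fun n => F n (g n)) n₀ :=
    hF.comp n₀ (contMDiffAt_id.prodMk hg)
  exact ContMDiffAt.clm_apply_of_inCoordinates h1 hv h2

/-- The Lie bracket of vector fields on a normed space acts on functions as the commutator of
derivations. -/
theorem fderiv_lieBracket_apply {f : E → ℝ} {p : E} (hf : ContDiffAt ℝ 2 f p) {V W : E → E}
    (hV : DifferentiableAt ℝ V p) (hW : DifferentiableAt ℝ W p) :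
    fderiv ℝ f p (VectorField.lieBracket ℝ V W p) =
      fderiv ℝ (fun x => fderiv ℝ f x (W x)) p (V p) -
        fderiv ℝ (fun x => fderiv ℝ f x (V x)) p (W p) := by
  have hd : DifferentiableAt ℝ (fderiv ℝ f) p :=
    (hf.fderiv_right (m := 1) le_rfl).differentiableAt one_ne_zero
  -- The second-order terms of the two iterated derivatives cancel by this symmetry.
  have hs : IsSymmSndFDerivAt ℝ f p := hf.isSymmSndFDerivAt (by simp)
  rw [fderiv_clm_apply hd hV, fderiv_clm_apply hd hW]
  simp [VectorField.lieBracket, hs.eq (V p) (W p)]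

/-- The Lie bracket of vector fields acts on functions as the commutator of derivations. -/
theorem mfderiv_mlieBracket_apply [CompleteSpace E] [IsManifold 𝓘(ℝ, E) ∞ N] {f : N → ℝ} {p : N}
    (hf : ContMDiffAt 𝓘(ℝ, E) 𝓘(ℝ, ℝ) ∞ f p) {V W : ∀ x : N, TangentSpace 𝓘(ℝ, E) x}
    (hV : MDifferentiableAt 𝓘(ℝ, E) 𝓘(ℝ, E).tangent
      (fun x => (⟨x, V x⟩ : TangentBundle 𝓘(ℝ, E) N)) p)
    (hW : MDifferentiableAt 𝓘(ℝ, E) 𝓘(ℝ, E).tangent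
      (fun x => (⟨x, W x⟩ : TangentBundle 𝓘(ℝ, E) N)) p)
    {fV fW : N → ℝ} (hfV : ∀ᶠ x in 𝓝 p, fV x = dirDeriv f x (V x))
    (hfW : ∀ᶠ x in 𝓝 p, fW x = dirDeriv f x (W x))
    (hfV' : MDifferentiableAt 𝓘(ℝ, E) 𝓘(ℝ, ℝ) fV p)
    (hfW' : MDifferentiableAt 𝓘(ℝ, E) 𝓘(ℝ, ℝ) fW p) :
    dirDeriv f p (VectorField.mlieBracket 𝓘(ℝ, E) V W p) =
      dirDeriv fW p (V p) -
        dirDeriv fV p (W p) := by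
  have : IsManifold 𝓘(ℝ, E) 2 N :=
    IsManifold.of_le (n := ∞) (WithTop.coe_le_coe.2 (le_top : (2 : ℕ∞) ≤ ⊤))
  set φ := extChartAt 𝓘(ℝ, E) p with hφ
  -- Vector fields are pulled back to the chart at `p`, where `mlieBracket` is by definition the
  -- bracket of a normed space.
  let hat (V : ∀ x : N, TangentSpace 𝓘(ℝ, E) x) : E → E :=
    VectorField.mpullback 𝓘(ℝ, E) 𝓘(ℝ, E) φ.symm V
  have hpt : φ p ∈ φ.target := mem_extChartAt_target p
  have hφp : φ.symm (φ p) = p := extChartAt_to_inv p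
  have htend : Tendsto φ.symm (𝓝 (φ p)) (𝓝 p) := by
    have := continuousAt_extChartAt_symm (I := 𝓘(ℝ, E)) p
    rwa [ContinuousAt, hφp] at this
  have hsd : ∀ y ∈ φ.target, ContMDiffAt 𝓘(ℝ, E) 𝓘(ℝ, E) ∞ φ.symm y := fun y hy =>
    (contMDiffOn_extChartAt_symm p).contMDiffAt ((isOpen_extChartAt_target p).mem_nhds hy)
  have hinv : ∀ y ∈ φ.target, (mfderiv 𝓘(ℝ, E) 𝓘(ℝ, E) φ.symm y).IsInvertible := by
    intro y hy
    have := isInvertible_mfderivWithin_extChartAt_symm (I := 𝓘(ℝ, E)) hy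
    simpa only [modelWithCornersSelf_coe, Set.range_id, mfderivWithin_univ] using this
  have hhat : ∀ V : ∀ x : N, TangentSpace 𝓘(ℝ, E) x,
      MDifferentiableAt 𝓘(ℝ, E) 𝓘(ℝ, E).tangent
        (fun x => (⟨x, V x⟩ : TangentBundle 𝓘(ℝ, E) N)) p → DifferentiableAt ℝ (hat V) (φ p) := by
    intro V hV
    have := MDifferentiableWithinAt.differentiableWithinAt_mpullbackWithin_vectorField
      (s := Set.univ) hV.mdifferentiableWithinAt
    simp only [modelWithCornersSelf_coe, Set.range_id, Set.preimage_univ, Set.inter_univ,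
      VectorField.mpullbackWithin_univ] at this
    exact this.differentiableAt univ_mem
  have hfe := hf.eventually_mdifferentiableAt
  have hder : ∀ (k : N → ℝ) (V : ∀ x : N, TangentSpace 𝓘(ℝ, E) x), ∀ y ∈ φ.target,
      MDifferentiableAt 𝓘(ℝ, E) 𝓘(ℝ, ℝ) k (φ.symm y) →
      fderiv ℝ (k ∘ φ.symm) y (hat V y) =
        dirDeriv k (φ.symm y) (V (φ.symm y)) := by
    intro k V y h2 h1
    have h3 := mfderiv_comp y h1 ((hsd y h2).mdifferentiableAt (by simp))
    rw [← mfderiv_eq_fderiv, h3]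
    have h4 : mfderiv 𝓘(ℝ, E) 𝓘(ℝ, E) φ.symm y (hat V y) = V (φ.symm y) := by
      exact (hinv y h2).self_apply_inverse _
    exact congrArg (mfderiv 𝓘(ℝ, E) 𝓘(ℝ, ℝ) k (φ.symm y)) h4
  have hfun : ∀ (V : ∀ x : N, TangentSpace 𝓘(ℝ, E) x) (fV : N → ℝ),
      (∀ᶠ x in 𝓝 p, fV x = dirDeriv f x (V x)) →
      (fun y => fderiv ℝ (f ∘ φ.symm) y (hat V y)) =ᶠ[𝓝 (φ p)] fV ∘ φ.symm := by
    intro V fV h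
    filter_upwards [(isOpen_extChartAt_target p).mem_nhds hpt, htend.eventually h,
      htend.eventually hfe] with y h1 h2 h3
    rw [hder f V y h1 h3]; exact h2.symm
  have hpush : ∀ (V : ∀ x : N, TangentSpace 𝓘(ℝ, E) x) (k : N → ℝ),
      MDifferentiableAt 𝓘(ℝ, E) 𝓘(ℝ, ℝ) k p →
      fderiv ℝ (k ∘ φ.symm) (φ p) (hat V (φ p)) =
        dirDeriv k p (V p) := by
    intro V k hk
    rw [hder k V _ hpt (by rwa [hφp]), hφp]
  have hfs : ContDiffAt ℝ 2 (f ∘ φ.symm) (φ p) := by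
    have : ContMDiffAt 𝓘(ℝ, E) 𝓘(ℝ, ℝ) ∞ (f ∘ φ.symm) (φ p) :=
      ContMDiffAt.comp _ (by rw [hφp]; exact hf) (hsd _ hpt)
    exact this.contDiffAt.of_le (WithTop.coe_le_coe.2 (le_top : (2 : ℕ∞) ≤ ⊤))
  have key := fderiv_lieBracket_apply hfs (hhat V hV) (hhat W hW)
  rw [(hfun V fV hfV).fderiv_eq, (hfun W fW hfW).fderiv_eq, hpush V fW hfW', hpush W fV hfV'] at key
  rw [← key]
  have hφi : (mfderiv 𝓘(ℝ, E) 𝓘(ℝ, E) φ p).IsInvertible :=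
    isInvertible_mfderiv_extChartAt (mem_extChartAt_source p)
  have hcomp : mfderiv 𝓘(ℝ, E) 𝓘(ℝ, ℝ) f p =
      (fderiv ℝ (f ∘ φ.symm) (φ p)).comp (mfderiv 𝓘(ℝ, E) 𝓘(ℝ, E) φ p) := by
    have h1 : f =ᶠ[𝓝 p] (f ∘ φ.symm) ∘ φ := by
      filter_upwards [extChartAt_source_mem_nhds (I := 𝓘(ℝ, E)) p] with x hx
      simp only [Function.comp, hφ, (extChartAt 𝓘(ℝ, E) p).left_inv hx]
    have h2 := mfderiv_comp p (hfs.differentiableAt two_ne_zero).mdifferentiableAt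
      ((contMDiffAt_extChartAt (I := 𝓘(ℝ, E)) (n := 1) (x := p)).mdifferentiableAt one_ne_zero)
    rw [h1.mfderiv_eq]
    exact h2.trans (by rw [mfderiv_eq_fderiv]; rfl)
  have hbr : mfderiv 𝓘(ℝ, E) 𝓘(ℝ, E) φ p (VectorField.mlieBracket 𝓘(ℝ, E) V W p) =
      VectorField.lieBracket ℝ (hat V) (hat W) (φ p) := by
    rw [← VectorField.mlieBracketWithin_univ, VectorField.mlieBracketWithin_apply]
    simp only [modelWithCornersSelf_coe, Set.range_id, Set.preimage_univ, Set.inter_univ,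
      VectorField.mpullbackWithin_univ]
    exact (hφi.self_apply_inverse _).trans
      (congrFun (VectorField.lieBracketWithin_univ (V := hat V) (W := hat W)) (φ p))
  rw [dirDeriv, hcomp]
  exact congrArg (fderiv ℝ (f ∘ φ.symm) (φ p)) hbr

/-- Equalities of tangent vectors are kept in the total space because base points such as `s (one
x)` and `x` agree only propositionally. The transport `key` works since every tangent space is the
model space by definition. -/
theorem tangentMap_congr_of_eventuallyEq {f g : N → P} {v : TangentBundle 𝓘(ℝ, E) N}
    (h : f =ᶠ[𝓝 v.1] g) :
    tangentMap 𝓘(ℝ, E) 𝓘(ℝ, E') f v = tangentMap 𝓘(ℝ, E) 𝓘(ℝ, E') g v := by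
  have key : ∀ (b b' : P), b = b' → ∀ w : E', (⟨b, w⟩ : TangentBundle 𝓘(ℝ, E') P) = ⟨b', w⟩ := by
    rintro b _ rfl w
    rfl
  have h1 := h.mfderiv_eq (I := 𝓘(ℝ, E)) (I' := 𝓘(ℝ, E'))
  refine (key _ _ h.self_of_nhds _).trans ?_
  exact congrArg (fun w : E' => (⟨g v.1, w⟩ : TangentBundle 𝓘(ℝ, E') P))
    (DFunLike.congr_fun h1 v.2)

theorem dirDeriv_comp {f : P → ℝ} {k : N → P} {v : TangentBundle 𝓘(ℝ, E) N}
    (hf : MDifferentiableAt 𝓘(ℝ, E') 𝓘(ℝ, ℝ) f (k v.1))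
    (hk : MDifferentiableAt 𝓘(ℝ, E) 𝓘(ℝ, E') k v.1) :
    dirDeriv (f ∘ k) v.1 v.2 =
      dirDeriv f (tangentMap 𝓘(ℝ, E) 𝓘(ℝ, E') k v).1 (tangentMap 𝓘(ℝ, E) 𝓘(ℝ, E') k v).2 :=
  mfderiv_comp_apply _ hf hk v.2

/-- In the normal form of a submersion, vertical vectors are the tangent vectors in the second
coordinate. -/
theorem tangentMap_local_section {t : N → P} {κ : N → E} {q : P × E → N} {h : N}
    (ht : MDifferentiableAt 𝓘(ℝ, E) 𝓘(ℝ, E') t h) (hκ : MDifferentiableAt 𝓘(ℝ, E) 𝓘(ℝ, E) κ h)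
    (hq : MDifferentiableAt (𝓘(ℝ, E').prod 𝓘(ℝ, E)) 𝓘(ℝ, E) q (t h, κ h))
    (hinv : ∀ᶠ h' in 𝓝 h, q (t h', κ h') = h') {a : TangentSpace 𝓘(ℝ, E) h}
    (ha : mfderiv 𝓘(ℝ, E) 𝓘(ℝ, E') t h a = 0) :
    tangentMap 𝓘(ℝ, E) 𝓘(ℝ, E) (fun e => q (t h, e)) (tangentMap 𝓘(ℝ, E) 𝓘(ℝ, E) κ ⟨h, a⟩) =
      ⟨h, a⟩ := by
  -- The identity `q (t h', κ h') = h'` is differentiated. As dt kills `a`, the inner velocity is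
  -- `(0, dκ a)`, which is also the velocity of `e ↦ (t h, e)`.
  have h1 : tangentMap 𝓘(ℝ, E) 𝓘(ℝ, E) (q ∘ fun h' => (t h', κ h')) ⟨h, a⟩ = ⟨h, a⟩ := by
    have h0 : (q ∘ fun h' => (t h', κ h')) =ᶠ[𝓝 h] id := hinv
    rw [tangentMap_congr_of_eventuallyEq h0, tangentMap_id]
    rfl
  rw [tangentMap_comp_at (I' := 𝓘(ℝ, E').prod 𝓘(ℝ, E)) _ hq (ht.prodMk hκ)] at h1
  have h2 := tangentMap_comp_at (I := 𝓘(ℝ, E)) (I' := 𝓘(ℝ, E').prod 𝓘(ℝ, E)) (I'' := 𝓘(ℝ, E))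
    (g := q) (f := fun e : E => (t h, e)) (tangentMap 𝓘(ℝ, E) 𝓘(ℝ, E) κ ⟨h, a⟩) hq
    (mdifferentiableAt_const.prodMk mdifferentiableAt_id)
  refine h2.trans (Eq.trans ?_ h1)
  congr 1
  rw [tangentMap_prod_right]
  have h3 := (ht.hasMFDerivAt.prodMk hκ.hasMFDerivAt).mfderiv
  simp only [tangentMap, h3]
  congr 1
  exact Prod.ext ha.symm rfl

end ManifoldPreliminaries
end

noncomputable section

/-! ### Logarithms of cocycles and local left translations -/

section GroupoidCochains

open Filter Topology

variable {E : Type*} [NormedAddCommGroup E] [NormedSpace ℝ E]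
  {N : Type*} [TopologicalSpace N] [ChartedSpace E N]

/-- `Real.log` is log|·|, smooth away from 0, so no positivity is needed and log|ψ| is available on
all of G. -/
theorem contMDiff_log_units {f : N → ℝˣ} (hf : ContMDiff 𝓘(ℝ, E) 𝓘(ℝ, ℝ) ∞ f) :
    ContMDiff 𝓘(ℝ, E) 𝓘(ℝ, ℝ) ∞ (fun x => Real.log (f x : ℝ)) := by
  have h1 : ContMDiff 𝓘(ℝ, E) 𝓘(ℝ, ℝ) ∞ (fun x => (f x : ℝ)) := Units.contMDiff_val.comp hf
  intro x
  exact ContMDiffAt.comp x (Real.contDiffAt_log.2 (f x).ne_zero).contMDiffAt (h1 x)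

variable {EM : Type*} [NormedAddCommGroup EM] [NormedSpace ℝ EM]
  {M : Type*} [TopologicalSpace M] [ChartedSpace EM M]
  {EG : Type*} [NormedAddCommGroup EG] [NormedSpace ℝ EG]
  {G : Type*} [TopologicalSpace G] [ChartedSpace EG G]

namespace LieGroupoid

variable (𝒢 : LieGroupoid EM M EG G)

variable {𝒢} in
theorem mul_one_of_s_eq {g : G} {x : M} (h : 𝒢.s g = x) : 𝒢.mul g (𝒢.one x) = g := by
  rw [← h, 𝒢.mul_one]

/-- The function `log |ψ|` of an `ℝˣ`-valued cochain. -/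
def logCochain (ψ : 𝒢.Cochain) (g : G) : ℝ := Real.log (ψ g : ℝ)

theorem contMDiff_logCochain (ψ : 𝒢.Cochain) :
    ContMDiff 𝓘(ℝ, EG) 𝓘(ℝ, ℝ) ∞ (𝒢.logCochain ψ) := contMDiff_log_units ψ.contMDiff

theorem mdifferentiableAt_logCochain (ψ : 𝒢.Cochain) (g : G) :
    MDifferentiableAt 𝓘(ℝ, EG) 𝓘(ℝ, ℝ) (𝒢.logCochain ψ) g :=
  (𝒢.contMDiff_logCochain ψ).mdifferentiableAt (by simp)

theorem logCochain_mul {φ : 𝒢.Cochain} (hφ : φ ∈ 𝒢.cocycles) {g h : G} (hgh : 𝒢.s g = 𝒢.t h) :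
    𝒢.logCochain φ (𝒢.mul g h) = 𝒢.logCochain φ g + 𝒢.logCochain φ h := by
  simp only [logCochain, hφ g h hgh, Units.val_mul]
  exact Real.log_mul (φ g).ne_zero (φ h).ne_zero

theorem cocycle_one {φ : 𝒢.Cochain} (hφ : φ ∈ 𝒢.cocycles) (x : M) : φ (𝒢.one x) = 1 := by
  have h := hφ (𝒢.one x) (𝒢.one x) (by rw [𝒢.s_one, 𝒢.t_one])
  rw [mul_one_of_s_eq (𝒢.s_one x)] at h
  exact left_eq_mul.1 h

/-- A cocycle is 1 on the units, so log|φ| is constant along them. Corrections by vectors tangent to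
the units, as in `sTangent` and `projA`, are therefore invisible to log|φ|. -/
theorem dirDeriv_logCochain_dOne {φ : 𝒢.Cochain} (hφ : φ ∈ 𝒢.cocycles) (x : M)
    (w : TangentSpace 𝓘(ℝ, EM) x) :
    dirDeriv (𝒢.logCochain φ) (𝒢.one x) (𝒢.dOne x w) = 0 := by
  have h0 : 𝒢.logCochain φ ∘ 𝒢.one = fun _ => (0 : ℝ) := by
    funext y
    simp [logCochain, 𝒢.cocycle_one hφ]
  have h2 := dirDeriv_comp (v := ⟨x, w⟩) (𝒢.mdifferentiableAt_logCochain φ (𝒢.one x))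
    (𝒢.one.contMDiff.mdifferentiableAt (x := x) (by simp))
  refine h2.symm.trans ?_
  rw [h0]
  exact DFunLike.congr_fun
    (hasMFDerivAt_const (I := 𝓘(ℝ, EM)) (I' := 𝓘(ℝ, ℝ)) (0 : ℝ) x).mfderiv w

theorem dirDeriv_sub (f : N → ℝ) (x : N) (v w : TangentSpace 𝓘(ℝ, E) x) :
    dirDeriv f x (v - w) = dirDeriv f x v - dirDeriv f x w :=
  map_sub (mfderiv 𝓘(ℝ, E) 𝓘(ℝ, ℝ) f x) v w

/-- On a cocycle, the van Est map is the derivative of `log |φ|` along the `t`-fibres. -/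
theorem vanEst_apply_of_mem_cocycles {φ : 𝒢.Cochain} (hφ : φ ∈ 𝒢.cocycles) (x : M) (a : 𝒢.A x) :
    𝒢.vanEst φ x a =
      dirDeriv (𝒢.logCochain φ) (𝒢.one x) (a : TangentSpace 𝓘(ℝ, EG) (𝒢.one x)) := by
  have h : 𝒢.vanEst φ x a = dirDeriv (𝒢.logCochain φ) (𝒢.one x)
      ((a : TangentSpace 𝓘(ℝ, EG) (𝒢.one x)) - 𝒢.dOne x (𝒢.anchor x a)) := rfl
  rw [h, dirDeriv_sub, 𝒢.dirDeriv_logCochain_dOne hφ, sub_zero]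

/-- On a cocycle, the van Est map does not see the projection to `A` along the units. -/
theorem vanEst_projA {φ : 𝒢.Cochain} (hφ : φ ∈ 𝒢.cocycles) (x : M)
    (v : TangentSpace 𝓘(ℝ, EG) (𝒢.one x)) :
    𝒢.vanEst φ x (𝒢.projA x v) = dirDeriv (𝒢.logCochain φ) (𝒢.one x) v := by
  rw [𝒢.vanEst_apply_of_mem_cocycles hφ]
  have h : dirDeriv (𝒢.logCochain φ) (𝒢.one x)
      (𝒢.projA x v : TangentSpace 𝓘(ℝ, EG) (𝒢.one x)) = dirDeriv (𝒢.logCochain φ) (𝒢.one x)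
      (v - 𝒢.dOne x (𝒢.dtUnit x v)) := rfl
  rw [h, dirDeriv_sub, 𝒢.dirDeriv_logCochain_dOne hφ, sub_zero]

variable [IsManifold 𝓘(ℝ, EM) ∞ M] [IsManifold 𝓘(ℝ, EG) ∞ G]

theorem isSmoothForm_vanEst {φ : 𝒢.Cochain} (hφ : φ ∈ 𝒢.cocycles) :
    IsSmoothForm (𝒢.vanEst φ) := by
  intro X
  simp only [𝒢.vanEst_apply_of_mem_cocycles hφ]
  intro x
  have h := contMDiffAt_mfderiv_apply_section (F := fun (_ : M) => 𝒢.logCochain φ)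
    (ContMDiffAt.comp (x, 𝒢.one x) (𝒢.contMDiff_logCochain φ (𝒢.one x)) contMDiffAt_snd)
    (X.contMDiff_toFun x)
  exact ((contMDiff_snd_tangentBundle_modelSpace ℝ 𝓘(ℝ, ℝ)).contMDiffAt).comp x h

variable [FiniteDimensional ℝ EM] [FiniteDimensional ℝ EG]

/-- Near a unit, left translation of vertical vectors is the derivative of a smooth family of maps
between open sets. -/
theorem exists_local_leftTranslation (x₀ : M) :
    ∃ (κ : G → EG) (H : G → EG → G) (q : M × EG → G),
      ContMDiffAt 𝓘(ℝ, EG) 𝓘(ℝ, EG) ∞ κ (𝒢.one x₀) ∧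
      ContMDiffAt (𝓘(ℝ, EG).prod 𝓘(ℝ, EG)) 𝓘(ℝ, EG) ∞ (Function.uncurry H)
        (𝒢.one x₀, κ (𝒢.one x₀)) ∧
      ∀ᶠ g in 𝓝 (𝒢.one x₀),
        MDifferentiableAt 𝓘(ℝ, EG) 𝓘(ℝ, EG) (H g) (κ (𝒢.one (𝒢.s g))) ∧
        MDifferentiableAt 𝓘(ℝ, EG) 𝓘(ℝ, EG) (fun e => q (𝒢.s g, e)) (κ (𝒢.one (𝒢.s g))) ∧
        (∀ᶠ e in 𝓝 (κ (𝒢.one (𝒢.s g))),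
          𝒢.t (q (𝒢.s g, e)) = 𝒢.s g ∧ H g e = 𝒢.mul g (q (𝒢.s g, e))) ∧
        (∀ a : 𝒢.A (𝒢.s g), tangentMap 𝓘(ℝ, EG) 𝓘(ℝ, EG) (fun e => q (𝒢.s g, e))
          (tangentMap 𝓘(ℝ, EG) 𝓘(ℝ, EG) κ ⟨𝒢.one (𝒢.s g), a⟩) = ⟨𝒢.one (𝒢.s g), a⟩) ∧
        ∀ X : 𝒢.AlgSection, tangentMap 𝓘(ℝ, EG) 𝓘(ℝ, EG) (H g)
          (tangentMap 𝓘(ℝ, EG) 𝓘(ℝ, EG) κ ⟨𝒢.one (𝒢.s g), X (𝒢.s g)⟩) =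
            ⟨g, X.leftInvariant g⟩ := by
  obtain ⟨κ, q, hκ, hq, hinv, ht⟩ := exists_local_section_of_submersion
    (𝒢.t.contMDiff (𝒢.one x₀)) (𝒢.t_submersion (𝒢.one x₀))
  rw [𝒢.t_one] at hq ht
  have hq₀ : q (x₀, κ (𝒢.one x₀)) = 𝒢.one x₀ := by
    simpa only [𝒢.t_one] using hinv.self_of_nhds
  -- The product is smooth only within the composable pairs. Since `q (s g, e)` lies in the t-fibre
  -- over `s g`, all parameters near the base point give composable pairs, and smoothness within
  -- this set becomes smoothness at the point.
  have hH : ContMDiffAt (𝓘(ℝ, EG).prod 𝓘(ℝ, EG)) 𝓘(ℝ, EG) ∞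
      (Function.uncurry fun g e => 𝒢.mul g (q (𝒢.s g, e))) (𝒢.one x₀, κ (𝒢.one x₀)) := by
    have h1 : ContMDiffAt (𝓘(ℝ, EG).prod 𝓘(ℝ, EG)) (𝓘(ℝ, EM).prod 𝓘(ℝ, EG)) ∞
        (fun z : G × EG => (𝒢.s z.1, z.2)) (𝒢.one x₀, κ (𝒢.one x₀)) :=
      (𝒢.s.contMDiff.comp contMDiff_fst).contMDiffAt.prodMk contMDiffAt_snd
    have h2 : ContMDiffAt (𝓘(ℝ, EG).prod 𝓘(ℝ, EG)) 𝓘(ℝ, EG) ∞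
        (fun z : G × EG => q (𝒢.s z.1, z.2)) (𝒢.one x₀, κ (𝒢.one x₀)) :=
      ContMDiffAt.comp (g := q) _ (by rw [𝒢.s_one]; exact hq) h1
    have h3 := contMDiffAt_fst.prodMk h2
    have h4 : ∀ᶠ z : G × EG in 𝓝 (𝒢.one x₀, κ (𝒢.one x₀)),
        𝒢.s z.1 = 𝒢.t (q (𝒢.s z.1, z.2)) := by
      have h5 := h1.continuousAt
      rw [ContinuousAt, 𝒢.s_one] at h5
      exact (h5.eventually ht).mono fun z hz => hz.symm
    have h6 := 𝒢.contMDiffOn_mul (𝒢.one x₀, 𝒢.one x₀) (by simp [𝒢.s_one, 𝒢.t_one])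
    have h7 := ContMDiffWithinAt.comp (I' := 𝓘(ℝ, EG).prod 𝓘(ℝ, EG))
      (f := fun z : G × EG => (z.1, q (𝒢.s z.1, z.2)))
      (s := {z : G × EG | 𝒢.s z.1 = 𝒢.t (q (𝒢.s z.1, z.2))}) (𝒢.one x₀, κ (𝒢.one x₀))
      (by simpa only [𝒢.s_one, hq₀] using h6) h3.contMDiffWithinAt fun z hz => hz
    exact h7.contMDiffAt h4
  refine ⟨κ, fun g e => 𝒢.mul g (q (𝒢.s g, e)), q, hκ, hH, ?_⟩
  have hone : Tendsto (fun g => 𝒢.one (𝒢.s g)) (𝓝 (𝒢.one x₀)) (𝓝 (𝒢.one x₀)) := by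
    have : ContinuousAt (fun g => 𝒢.one (𝒢.s g)) (𝒢.one x₀) :=
      (𝒢.one.contMDiff.continuous.comp 𝒢.s.contMDiff.continuous).continuousAt
    simpa only [ContinuousAt, 𝒢.s_one] using this
  have hs : Tendsto 𝒢.s (𝓝 (𝒢.one x₀)) (𝓝 x₀) := by
    simpa only [ContinuousAt, 𝒢.s_one] using 𝒢.s.contMDiff.continuous.continuousAt (x := 𝒢.one x₀)
  have hκone : Tendsto (fun g => κ (𝒢.one (𝒢.s g))) (𝓝 (𝒢.one x₀)) (𝓝 (κ (𝒢.one x₀))) :=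
    hκ.continuousAt.tendsto.comp hone
  have hz : Tendsto (fun g => (𝒢.s g, κ (𝒢.one (𝒢.s g)))) (𝓝 (𝒢.one x₀))
      (𝓝 (x₀, κ (𝒢.one x₀))) := hs.prodMk_nhds hκone
  filter_upwards [hone.eventually hκ.eventually_mdifferentiableAt,
    hz.eventually hq.eventually_mdifferentiableAt, hone.eventually hinv.eventually_nhds,
    hz.eventually ht.eventually_nhds,
    (tendsto_id.prodMk_nhds hκone).eventually hH.eventually_mdifferentiableAt] with g h1 h2 h3 h4 h5
  have ht1 : 𝒢.t (𝒢.one (𝒢.s g)) = 𝒢.s g := 𝒢.t_one _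
  have hq1 : q (𝒢.s g, κ (𝒢.one (𝒢.s g))) = 𝒢.one (𝒢.s g) := by
    simpa only [ht1] using h3.self_of_nhds
  have h6 : MDifferentiableAt 𝓘(ℝ, EG) 𝓘(ℝ, EG) (fun e => q (𝒢.s g, e))
      (κ (𝒢.one (𝒢.s g))) :=
    MDifferentiableAt.comp (I' := 𝓘(ℝ, EM).prod 𝓘(ℝ, EG)) (κ (𝒢.one (𝒢.s g))) h2
      (mdifferentiableAt_const.prodMk mdifferentiableAt_id)
  have h7 : ∀ᶠ e in 𝓝 (κ (𝒢.one (𝒢.s g))), 𝒢.t (q (𝒢.s g, e)) = 𝒢.s g :=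
    ((Continuous.prodMk_right (𝒢.s g)).continuousAt (x := κ (𝒢.one (𝒢.s g)))).eventually h4
  have h8 : ∀ a : 𝒢.A (𝒢.s g), tangentMap 𝓘(ℝ, EG) 𝓘(ℝ, EG) (fun e => q (𝒢.s g, e))
      (tangentMap 𝓘(ℝ, EG) 𝓘(ℝ, EG) κ ⟨𝒢.one (𝒢.s g), a⟩) = ⟨𝒢.one (𝒢.s g), a⟩ := by
    intro a
    have := tangentMap_local_section (𝒢.t.contMDiff.mdifferentiableAt (by simp)) h1
      (by rw [ht1]; exact h2) h3 (LinearMap.mem_ker.1 a.2)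
    simpa only [ht1] using this
  refine ⟨MDifferentiableAt.comp (I' := 𝓘(ℝ, EG).prod 𝓘(ℝ, EG))
      (g := Function.uncurry fun g e => 𝒢.mul g (q (𝒢.s g, e))) (f := fun e => (g, e))
      (κ (𝒢.one (𝒢.s g))) h5 (mdifferentiableAt_const.prodMk mdifferentiableAt_id), h6,
    h7.mono fun e he => ⟨he, rfl⟩, h8, fun X => ?_⟩
  set S : Set G := {h | 𝒢.t h = 𝒢.s g} with hS
  have h9 : MDifferentiableWithinAt 𝓘(ℝ, EG) 𝓘(ℝ, EG) (𝒢.mul g) S (𝒢.one (𝒢.s g)) := by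
    have := (𝒢.contMDiffOn_mul (g, 𝒢.one (𝒢.s g)) ht1.symm).mdifferentiableWithinAt (by simp)
    exact this.comp (I' := 𝓘(ℝ, EG).prod 𝓘(ℝ, EG)) (𝒢.one (𝒢.s g))
      (f := fun h : G => (g, h)) (s := S)
      (mdifferentiableWithinAt_const.prodMk mdifferentiableWithinAt_id) fun h hh => Eq.symm hh
  set v := tangentMap 𝓘(ℝ, EG) 𝓘(ℝ, EG) κ ⟨𝒢.one (𝒢.s g), X (𝒢.s g)⟩ with hv
  have h10 : tangentMap 𝓘(ℝ, EG) 𝓘(ℝ, EG) (fun e => 𝒢.mul g (q (𝒢.s g, e))) v =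
      tangentMapWithin 𝓘(ℝ, EG) 𝓘(ℝ, EG) (𝒢.mul g) S
        (tangentMap 𝓘(ℝ, EG) 𝓘(ℝ, EG) (fun e => q (𝒢.s g, e)) v) := by
    -- The fibre `S` need not determine its derivative on all of the tangent space. The chain rule
    -- asks for unique differentiability only of the source `univ`, so it fixes the value of
    -- `mfderivWithin` on vertical vectors, whichever derivative was chosen.
    have h11 := mfderivWithin_comp_of_preimage_mem_nhdsWithin (κ (𝒢.one (𝒢.s g)))
      (g := 𝒢.mul g) (f := fun e => q (𝒢.s g, e)) (u := S) (s := Set.univ)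
      (by rw [hq1]; exact h9) h6.mdifferentiableWithinAt (by rw [nhdsWithin_univ]; exact h7)
      (uniqueMDiffWithinAt_univ 𝓘(ℝ, EG))
    rw [mfderivWithin_univ, mfderivWithin_univ] at h11
    exact congrArg (fun w => (⟨_, w⟩ : TangentBundle 𝓘(ℝ, EG) G)) (DFunLike.congr_fun h11 v.2)
  rw [h10, h8]
  have key : ∀ (b b' : G), b = b' → ∀ w : EG,
      (⟨b, w⟩ : TangentBundle 𝓘(ℝ, EG) G) = ⟨b', w⟩ := by
    rintro b _ rfl w
    rfl
  exact key _ _ (𝒢.mul_one g) _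

end LieGroupoid
end GroupoidCochains
end

noncomputable section

/-! ### The van Est map on cocycles and on cohomology -/

section VanEstCocycles

open Filter Topology

variable {EM : Type*} [NormedAddCommGroup EM] [NormedSpace ℝ EM]
  {M : Type*} [TopologicalSpace M] [ChartedSpace EM M]
  {EG : Type*} [NormedAddCommGroup EG] [NormedSpace ℝ EG]
  {G : Type*} [TopologicalSpace G] [ChartedSpace EG G]

namespace LieGroupoid

variable (𝒢 : LieGroupoid EM M EG G) [IsManifold 𝓘(ℝ, EM) ∞ M] [IsManifold 𝓘(ℝ, EG) ∞ G]
  [FiniteDimensional ℝ EM] [FiniteDimensional ℝ EG]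

/-- Near a unit the field is the image of the smooth field `X ∘ s` along `one ∘ s` under dκ followed
by the differential of `H g`. -/
theorem mdifferentiableAt_leftInvariant (X : 𝒢.AlgSection) (x : M) :
    MDifferentiableAt 𝓘(ℝ, EG) 𝓘(ℝ, EG).tangent
      (fun g => (⟨g, X.leftInvariant g⟩ : TangentBundle 𝓘(ℝ, EG) G)) (𝒢.one x) := by
  obtain ⟨κ, H, q, hκ, hH, hloc⟩ := 𝒢.exists_local_leftTranslation x
  have h1 : ContMDiffAt 𝓘(ℝ, EG) 𝓘(ℝ, EG).tangent ∞
      (fun g => (⟨𝒢.one (𝒢.s g), X (𝒢.s g)⟩ : TangentBundle 𝓘(ℝ, EG) G)) (𝒢.one x) :=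
    (X.contMDiff_toFun.comp 𝒢.s.contMDiff) (𝒢.one x)
  have h2 := contMDiffAt_mfderiv_apply_section (F := fun (_ : G) => κ)
    (g := fun g => 𝒢.one (𝒢.s g)) (n₀ := 𝒢.one x)
    (ContMDiffAt.comp (I' := 𝓘(ℝ, EG)) (g := κ) (f := Prod.snd) _
      (by simpa only [𝒢.s_one] using hκ) contMDiffAt_snd) h1
  have h3 := contMDiffAt_mfderiv_apply_section (F := H) (g := fun g => κ (𝒢.one (𝒢.s g)))
    (n₀ := 𝒢.one x) (by simpa only [𝒢.s_one] using hH) h2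
  refine (h3.congr_of_eventuallyEq ?_).mdifferentiableAt (by simp)
  filter_upwards [hloc] with g hg
  exact (hg.2.2.2.2 X).symm

/-- By log|φ|(gh) = log|φ|(g) + log|φ|(h), differentiation in h along the t-fibre gives the same
result at g as at the unit of `s g`. Validity near the units suffices for the bracket there. -/
theorem eventually_dirDeriv_leftInvariant {φ : 𝒢.Cochain} (hφ : φ ∈ 𝒢.cocycles)
    (X : 𝒢.AlgSection) (x : M) :
    ∀ᶠ g in 𝓝 (𝒢.one x), 𝒢.vanEst φ (𝒢.s g) (X (𝒢.s g)) =
      dirDeriv (𝒢.logCochain φ) g (X.leftInvariant g) := by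
  obtain ⟨κ, H, q, hκ, hH, hloc⟩ := 𝒢.exists_local_leftTranslation x
  filter_upwards [hloc] with g hg
  obtain ⟨h1, h2, h3, h4, h5⟩ := hg
  set v := tangentMap 𝓘(ℝ, EG) 𝓘(ℝ, EG) κ ⟨𝒢.one (𝒢.s g), X (𝒢.s g)⟩ with hv
  have e1 := dirDeriv_comp (v := v) (𝒢.mdifferentiableAt_logCochain φ _) h1
  have e2 := dirDeriv_comp (v := v) (𝒢.mdifferentiableAt_logCochain φ _) h2
  rw [h5 X] at e1
  rw [h4 (X (𝒢.s g))] at e2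
  have e3 : 𝒢.logCochain φ ∘ H g =ᶠ[𝓝 v.1] fun e =>
      𝒢.logCochain φ g + (𝒢.logCochain φ ∘ fun e => q (𝒢.s g, e)) e := by
    filter_upwards [h3] with e he
    simp only [Function.comp, he.2, 𝒢.logCochain_mul hφ he.1.symm]
  have e4 : dirDeriv (𝒢.logCochain φ ∘ H g) v.1 v.2 =
      dirDeriv (𝒢.logCochain φ ∘ fun e => q (𝒢.s g, e)) v.1 v.2 := by
    have h6 : MDifferentiableAt 𝓘(ℝ, EG) 𝓘(ℝ, ℝ) (𝒢.logCochain φ ∘ fun e => q (𝒢.s g, e)) v.1 :=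
      MDifferentiableAt.comp _ (𝒢.mdifferentiableAt_logCochain φ _) h2
    have h7 := ((hasMFDerivAt_const (I := 𝓘(ℝ, EG)) (I' := 𝓘(ℝ, ℝ)) (𝒢.logCochain φ g) v.1).add
      h6.hasMFDerivAt).mfderiv
    have h8 := e3.mfderiv_eq (I := 𝓘(ℝ, EG)) (I' := 𝓘(ℝ, ℝ))
    exact (DFunLike.congr_fun (h8.trans h7) v.2).trans (zero_add _)
  rw [𝒢.vanEst_apply_of_mem_cocycles hφ]
  exact e2.symm.trans (e4.symm.trans e1)

/-- Left multiplication by a unit is the identity on its t-fibre, so `H (one x)` agrees locally with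
the parametrization by `q`. -/
theorem leftInvariant_one (X : 𝒢.AlgSection) (x : M) :
    (⟨𝒢.one x, X.leftInvariant (𝒢.one x)⟩ : TangentBundle 𝓘(ℝ, EG) G) = ⟨𝒢.one x, X x⟩ := by
  obtain ⟨κ, H, q, hκ, hH, hloc⟩ := 𝒢.exists_local_leftTranslation x
  obtain ⟨h1, h2, h3, h4, h5⟩ := hloc.self_of_nhds
  set v := tangentMap 𝓘(ℝ, EG) 𝓘(ℝ, EG) κ
    ⟨𝒢.one (𝒢.s (𝒢.one x)), X (𝒢.s (𝒢.one x))⟩ with hv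
  have e1 : H (𝒢.one x) =ᶠ[𝓝 v.1] fun e => q (𝒢.s (𝒢.one x), e) := by
    filter_upwards [h3] with e he
    rw [he.2]
    have h6 : 𝒢.t (q (𝒢.s (𝒢.one x), e)) = x := he.1.trans (𝒢.s_one x)
    conv_rhs => rw [← 𝒢.one_mul (q (𝒢.s (𝒢.one x), e)), h6]
  rw [← h5 X, tangentMap_congr_of_eventuallyEq e1, h4]
  exact congrArg (fun y => (⟨𝒢.one y, X y⟩ : TangentBundle 𝓘(ℝ, EG) G)) (𝒢.s_one x)

omit [IsManifold 𝓘(ℝ, EM) ∞ M] [IsManifold 𝓘(ℝ, EG) ∞ G] [FiniteDimensional ℝ EM]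
  [FiniteDimensional ℝ EG] in
theorem dirDeriv_comp_s {f : M → ℝ} {x : M} (hf : MDifferentiableAt 𝓘(ℝ, EM) 𝓘(ℝ, ℝ) f x)
    (a : 𝒢.A x) :
    dirDeriv (fun g => f (𝒢.s g)) (𝒢.one x) (a : TangentSpace 𝓘(ℝ, EG) (𝒢.one x)) =
      𝒢.anchorDeriv f x a := by
  have key : ∀ b, b = x → ∀ w : EM, dirDeriv (E := EM) f b w = dirDeriv (E := EM) f x w := by
    rintro b rfl w
    rfl
  have e1 := dirDeriv_comp (v := (⟨𝒢.one x, a⟩ : TangentBundle 𝓘(ℝ, EG) G)) (f := f) (k := 𝒢.s)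
    (by simpa only [𝒢.s_one] using hf) (𝒢.s.contMDiff.mdifferentiableAt (by simp))
  exact e1.trans (key _ (𝒢.s_one x) _)

omit [IsManifold 𝓘(ℝ, EM) ∞ M] [IsManifold 𝓘(ℝ, EG) ∞ G] [FiniteDimensional ℝ EM]
  [FiniteDimensional ℝ EG] in
theorem dirDeriv_comp_t {f : M → ℝ} {x : M} (hf : MDifferentiableAt 𝓘(ℝ, EM) 𝓘(ℝ, ℝ) f x)
    (a : 𝒢.A x) :
    dirDeriv (fun g => f (𝒢.t g)) (𝒢.one x) (a : TangentSpace 𝓘(ℝ, EG) (𝒢.one x)) = 0 := by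
  have e1 := dirDeriv_comp (v := (⟨𝒢.one x, a⟩ : TangentBundle 𝓘(ℝ, EG) G)) (f := f) (k := 𝒢.t)
    (by simpa only [𝒢.t_one] using hf) (𝒢.t.contMDiff.mdifferentiableAt (by simp))
  refine e1.trans ((congrArg (dirDeriv f (𝒢.t (𝒢.one x))) (LinearMap.mem_ker.1 a.2)).trans ?_)
  exact map_zero (mfderiv 𝓘(ℝ, EM) 𝓘(ℝ, ℝ) f (𝒢.t (𝒢.one x)))

/-- The van Est map sends groupoid cocycles to Lie algebroid cocycles. -/
theorem vanEst_mem_algCocycles {φ : 𝒢.Cochain} (hφ : φ ∈ 𝒢.cocycles) :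
    𝒢.vanEst φ ∈ 𝒢.algCocycles := by
  have hsm := 𝒢.isSmoothForm_vanEst hφ
  refine ⟨hsm, fun X Y x => ?_⟩
  have hd : ∀ (Z : 𝒢.AlgSection) (y : M),
      MDifferentiableAt 𝓘(ℝ, EM) 𝓘(ℝ, ℝ) (fun y => 𝒢.vanEst φ y (Z y)) y := fun Z y =>
    (hsm Z).mdifferentiableAt (by simp)
  have hs : MDifferentiableAt 𝓘(ℝ, EG) 𝓘(ℝ, EM) 𝒢.s (𝒢.one x) :=
    𝒢.s.contMDiff.mdifferentiableAt (by simp)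
  -- The first derivatives of log|φ| are the functions Vφ(X)∘s and Vφ(Y)∘s. Differentiating these at
  -- the unit in turn gives anchor derivatives.
  have key := mfderiv_mlieBracket_apply (𝒢.contMDiff_logCochain φ (𝒢.one x))
    (𝒢.mdifferentiableAt_leftInvariant X x) (𝒢.mdifferentiableAt_leftInvariant Y x)
    (𝒢.eventually_dirDeriv_leftInvariant hφ X x) (𝒢.eventually_dirDeriv_leftInvariant hφ Y x)
    (MDifferentiableAt.comp (𝒢.one x) (hd X _) hs) (MDifferentiableAt.comp (𝒢.one x) (hd Y _) hs)
  have hX : ∀ Z : 𝒢.AlgSection, (⟨𝒢.one x, Z.leftInvariant (𝒢.one x)⟩ :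
      TangentBundle 𝓘(ℝ, EG) G) = ⟨𝒢.one x, Z x⟩ := fun Z => 𝒢.leftInvariant_one Z x
  have hanchor : ∀ Z W : 𝒢.AlgSection,
      dirDeriv (fun g => 𝒢.vanEst φ (𝒢.s g) (Z (𝒢.s g))) (𝒢.one x) (W.leftInvariant (𝒢.one x)) =
        𝒢.anchorDeriv (fun y => 𝒢.vanEst φ y (Z y)) x (W x) := by
    intro Z W
    have e1 := congrArg (fun v : TangentBundle 𝓘(ℝ, EG) G =>
      dirDeriv (fun g => 𝒢.vanEst φ (𝒢.s g) (Z (𝒢.s g))) v.1 v.2) (hX W)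
    exact e1.trans (𝒢.dirDeriv_comp_s (hd Z x) (W x))
  rw [hanchor, hanchor] at key
  -- Because Vφ ignores `projA`, tangency of the bracket to the t-fibre is not needed.
  rw [AlgSection.bracket, 𝒢.vanEst_projA hφ, key, sub_self]

omit [IsManifold 𝓘(ℝ, EM) ∞ M] [IsManifold 𝓘(ℝ, EG) ∞ G] [FiniteDimensional ℝ EM]
  [FiniteDimensional ℝ EG] in
theorem coboundaries_le_cocycles : 𝒢.coboundaries ≤ 𝒢.cocycles := by
  rintro φ ⟨f, hf⟩ g h hgh
  rw [hf, hf, hf, 𝒢.s_mul g h hgh, 𝒢.t_mul g h hgh, hgh, mul_comm, div_mul_div_cancel]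

omit [IsManifold 𝓘(ℝ, EM) ∞ M] [IsManifold 𝓘(ℝ, EG) ∞ G] [FiniteDimensional ℝ EM]
  [FiniteDimensional ℝ EG] in
/-- The van Est map sends groupoid coboundaries to Lie algebroid coboundaries. -/
theorem vanEst_mem_algCoboundaries {φ : 𝒢.Cochain} (hφ : φ ∈ 𝒢.coboundaries) :
    𝒢.vanEst φ ∈ 𝒢.algCoboundaries := by
  obtain ⟨f, hf⟩ := id hφ
  have hl := contMDiff_log_units f.contMDiff
  -- The primitive is log|f|; the term through `t` vanishes on A = ker dt.
  refine ⟨⟨_, hl⟩, fun x a => ?_⟩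
  rw [𝒢.vanEst_apply_of_mem_cocycles (𝒢.coboundaries_le_cocycles hφ)]
  have h1 : 𝒢.logCochain φ = (fun g => Real.log (f (𝒢.s g) : ℝ)) -
      fun g => Real.log (f (𝒢.t g) : ℝ) := by
    funext g
    simp only [logCochain, hf g, Units.val_div_eq_div_val, Pi.sub_apply]
    exact Real.log_div (f (𝒢.s g)).ne_zero (f (𝒢.t g)).ne_zero
  have hd : ∀ k : C^∞⟮𝓘(ℝ, EG), G; 𝓘(ℝ, EM), M⟯,
      MDifferentiableAt 𝓘(ℝ, EG) 𝓘(ℝ, ℝ) (fun g => Real.log (f (k g) : ℝ)) (𝒢.one x) := fun k =>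
    (hl.comp k.contMDiff).mdifferentiableAt (by simp)
  have h2 := ((hd 𝒢.s).hasMFDerivAt.sub (hd 𝒢.t).hasMFDerivAt).mfderiv
  have h3 : dirDeriv (𝒢.logCochain φ) (𝒢.one x) (a : TangentSpace 𝓘(ℝ, EG) (𝒢.one x)) =
      dirDeriv (fun g => Real.log (f (𝒢.s g) : ℝ)) (𝒢.one x)
        (a : TangentSpace 𝓘(ℝ, EG) (𝒢.one x)) -
      dirDeriv (fun g => Real.log (f (𝒢.t g) : ℝ)) (𝒢.one x)
        (a : TangentSpace 𝓘(ℝ, EG) (𝒢.one x)) := by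
    rw [h1]
    exact DFunLike.congr_fun h2 _
  rw [h3, 𝒢.dirDeriv_comp_s (hl.mdifferentiableAt (by simp)),
    𝒢.dirDeriv_comp_t (f := fun y => Real.log (f y : ℝ)) (hl.mdifferentiableAt (by simp)), sub_zero]
  rfl

omit [IsManifold 𝓘(ℝ, EM) ∞ M] [IsManifold 𝓘(ℝ, EG) ∞ G] [FiniteDimensional ℝ EM]
  [FiniteDimensional ℝ EG] in
theorem vanEst_mul {φ ψ : 𝒢.Cochain} :
    𝒢.vanEst (φ * ψ) = 𝒢.vanEst φ + 𝒢.vanEst ψ := by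
  have h1 : 𝒢.logCochain (φ * ψ) = 𝒢.logCochain φ + 𝒢.logCochain ψ := by
    funext g
    exact Real.log_mul (φ g).ne_zero (ψ g).ne_zero
  funext x
  refine LinearMap.ext fun a => ?_
  have h2 := ((𝒢.mdifferentiableAt_logCochain φ (𝒢.one x)).hasMFDerivAt.add
    (𝒢.mdifferentiableAt_logCochain ψ (𝒢.one x)).hasMFDerivAt).mfderiv
  rw [← h1] at h2
  exact DFunLike.congr_fun h2 (𝒢.sTangent x a)

/-- The van Est map on cocycles. -/
def vanEstCocycles : Additive 𝒢.cocycles →+ 𝒢.algCocycles where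
  toFun φ := ⟨𝒢.vanEst φ.toMul.1, 𝒢.vanEst_mem_algCocycles φ.toMul.2⟩
  map_zero' := by
    have h := 𝒢.vanEst_mul (φ := 1) (ψ := 1)
    rw [_root_.mul_one] at h
    exact Subtype.ext (left_eq_add.1 h)
  map_add' _ _ := Subtype.ext 𝒢.vanEst_mul

/-- The map `H¹(G; ℝˣ) → H¹(A)` induced by the van Est map. -/
def vanEstH1 : Additive 𝒢.H1 →+ 𝒢.AlgH1 :=
  AddMonoidHom.toMultiplicativeRight.symm <|
    QuotientGroup.lift (𝒢.coboundaries.subgroupOf 𝒢.cocycles)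
      (AddMonoidHom.toMultiplicativeRight
        ((𝒢.algCoboundaries.submoduleOf 𝒢.algCocycles).mkQ.toAddMonoidHom.comp 𝒢.vanEstCocycles))
      fun _ hφ => (Submodule.Quotient.mk_eq_zero _).2 (𝒢.vanEst_mem_algCoboundaries hφ)

theorem vanEstH1_mk (φ : 𝒢.cocycles) : 𝒢.vanEstH1 (Additive.ofMul (H1.mk 𝒢 φ)) =
    AlgH1.mk 𝒢 ⟨𝒢.vanEst φ.1, 𝒢.vanEst_mem_algCocycles φ.2⟩ := rfl

theorem isInducedByVanEst_vanEstH1 : 𝒢.IsInducedByVanEst 𝒢.vanEstH1 := fun φ =>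
  ⟨⟨𝒢.vanEst φ.1, 𝒢.vanEst_mem_algCocycles φ.2⟩, rfl, 𝒢.vanEstH1_mk φ⟩

theorem eq_vanEstH1_of_isInducedByVanEst {F : Additive 𝒢.H1 →+ 𝒢.AlgH1}
    (hF : 𝒢.IsInducedByVanEst F) : F = 𝒢.vanEstH1 := by
  refine AddMonoidHom.ext fun c => ?_
  obtain ⟨φ, rfl⟩ := QuotientGroup.mk_surjective (Additive.toMul c)
  obtain ⟨θ, hθ, h⟩ := hF φ
  have : θ = ⟨𝒢.vanEst φ.1, 𝒢.vanEst_mem_algCocycles φ.2⟩ := Subtype.ext hθ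
  exact h.trans ((congrArg (AlgH1.mk 𝒢) this).trans (𝒢.vanEstH1_mk φ).symm)

end LieGroupoid
end VanEstCocycles
end

noncomputable section

/-! ### Characteristic functions and forms of line bundle representations -/

section LineBundles

open Filter Topology

/-- This removes the casts in `act_mul` once it is applied to the values of a section. -/
theorem fiberCast_apply_section {M : Type*} {L : M → Type*} [∀ x, AddCommGroup (L x)]
    [∀ x, Module ℝ (L x)] (σ : ∀ x, L x) {x y : M} (h : x = y) :
    fiberCast L h (σ x) = σ y := by
  subst h
  rfl

variable {EM : Type*} [NormedAddCommGroup EM] [NormedSpace ℝ EM]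
  {M : Type*} [TopologicalSpace M] [ChartedSpace EM M]
  {EG : Type*} [NormedAddCommGroup EG] [NormedSpace ℝ EG]
  {G : Type*} [TopologicalSpace G] [ChartedSpace EG G]
  {L : M → Type*} [∀ x, AddCommGroup (L x)] [∀ x, Module ℝ (L x)]
  [∀ x, TopologicalSpace (L x)] [TopologicalSpace (TotalSpace ℝ L)] [FiberBundle ℝ L]
  [VectorBundle ℝ ℝ L]

/-- The scalars relating two smooth nonvanishing sections of a line bundle along the same map
depend smoothly on the point. -/
theorem exists_contMDiff_units_smul_eq [ContMDiffVectorBundle ∞ ℝ L 𝓘(ℝ, EM)] {b : G → M}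
    {A B : ∀ g, L (b g)}
    (hA : ContMDiff 𝓘(ℝ, EG) (𝓘(ℝ, EM).prod 𝓘(ℝ, ℝ)) ∞
      (fun g => (⟨b g, A g⟩ : TotalSpace ℝ L)))
    (hB : ContMDiff 𝓘(ℝ, EG) (𝓘(ℝ, EM).prod 𝓘(ℝ, ℝ)) ∞
      (fun g => (⟨b g, B g⟩ : TotalSpace ℝ L)))
    (hA0 : ∀ g, A g ≠ 0) (hB0 : ∀ g, B g ≠ 0) :
    ∃ c : C^∞⟮𝓘(ℝ, EG), G; 𝓘(ℝ, ℝ), ℝˣ⟯, ∀ g, A g = (c g : ℝ) • B g := by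
  have hcoord : ∀ (e : Trivialization ℝ (π ℝ L)) [MemTrivializationAtlas e] (y : M),
      y ∈ e.baseSet → ∀ v : L y, v ≠ 0 → (e ⟨y, v⟩).2 ≠ 0 := by
    intro e _ y hy v hv h0
    have h1 : e.continuousLinearEquivAt ℝ y hy v = 0 := h0
    exact hv ((e.continuousLinearEquivAt ℝ y hy).map_eq_zero_iff.1 h1)
  have hsmul : ∀ (e : Trivialization ℝ (π ℝ L)) [MemTrivializationAtlas e] (y : M),
      y ∈ e.baseSet → ∀ (r : ℝ) (v : L y), (e ⟨y, r • v⟩).2 = r * (e ⟨y, v⟩).2 := by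
    intro e _ y hy r v
    exact (e.continuousLinearEquivAt ℝ y hy).map_smul r v
  have hex : ∀ g, ∃ c : ℝˣ, A g = (c : ℝ) • B g := by
    intro g
    set e := trivializationAt ℝ L (b g) with he
    have hy : b g ∈ e.baseSet := mem_baseSet_trivializationAt ℝ L (b g)
    have ha := hcoord e _ hy _ (hA0 g)
    have hb := hcoord e _ hy _ (hB0 g)
    refine ⟨Units.mk0 _ (div_ne_zero ha hb), ?_⟩
    apply (e.continuousLinearEquivAt ℝ (b g) hy).injective
    have h1 : (e ⟨b g, A g⟩).2 = ((e ⟨b g, A g⟩).2 / (e ⟨b g, B g⟩).2) * (e ⟨b g, B g⟩).2 :=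
      (div_mul_cancel₀ _ hb).symm
    exact h1.trans (hsmul e _ hy _ _).symm
  choose c hc using hex
  -- Smoothness into ℝˣ is tested in ℝ, where `c` is locally the quotient of the fibre coordinates
  -- in one fixed trivialization.
  refine ⟨⟨c, ContMDiff.of_comp_isOpenEmbedding Units.isOpenEmbedding_val fun g₀ => ?_⟩, hc⟩
  set e := trivializationAt ℝ L (b g₀) with he
  have hy : b g₀ ∈ e.baseSet := mem_baseSet_trivializationAt ℝ L (b g₀)
  have h1 := contMDiffAt_totalSpace.1 (hA g₀)
  have h2 := contMDiffAt_totalSpace.1 (hB g₀)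
  refine (h1.2.div₀ h2.2 (hcoord e _ hy _ (hB0 g₀))).congr_of_eventuallyEq ?_
  filter_upwards [h1.1.continuousAt.eventually_mem (e.open_baseSet.mem_nhds hy)] with g hg
  have h3 := hsmul e _ hg (c g) (B g)
  rw [← hc g] at h3
  exact (eq_div_iff (hcoord e _ hg _ (hB0 g))).2 h3.symm

namespace LineBundleRep

variable {𝒢 : LieGroupoid EM M EG G} (Δ : LineBundleRep L 𝒢)

theorem contMDiff_act_section [ContMDiffVectorBundle ∞ ℝ L 𝓘(ℝ, EM)]
    (σ : Cₛ^∞⟮𝓘(ℝ, EM); ℝ, L⟯) :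
    ContMDiff 𝓘(ℝ, EG) (𝓘(ℝ, EM).prod 𝓘(ℝ, ℝ)) ∞
      (fun g => (⟨𝒢.t g, Δ.act g (σ (𝒢.s g))⟩ : TotalSpace ℝ L)) := by
  have h1 : ContMDiff 𝓘(ℝ, EG) (𝓘(ℝ, EG).prod 𝓘(ℝ, ℝ)) ∞
      (fun g => (⟨g, σ (𝒢.s g)⟩ : TotalSpace ℝ (𝒢.s *ᵖ L))) := by
    intro g
    have h2 := contMDiffAt_totalSpace.1 ((σ.contMDiff.comp 𝒢.s.contMDiff) g)
    -- The fibre coordinate in the pullback bundle is that of `L` at `s g`.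
    exact contMDiffAt_totalSpace.2 ⟨contMDiffAt_id, h2.2⟩
  exact Δ.contMDiff_act.comp h1

/-- The characteristic function of a nonvanishing section exists and is a cocycle. -/
theorem exists_isCharFun [ContMDiffVectorBundle ∞ ℝ L 𝓘(ℝ, EM)]
    (σ : Cₛ^∞⟮𝓘(ℝ, EM); ℝ, L⟯) (hσ : ∀ x, σ x ≠ 0) :
    ∃ φ : 𝒢.cocycles, Δ.IsCharFun σ φ.1 := by
  obtain ⟨φ, hφ⟩ := exists_contMDiff_units_smul_eq (Δ.contMDiff_act_section σ)
    (σ.contMDiff.comp 𝒢.t.contMDiff) (fun g => (Δ.act g).map_ne_zero_iff.2 (hσ _))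
    (fun g => hσ _)
  refine ⟨⟨φ, fun g h hgh => ?_⟩, hφ⟩
  have h1 := Δ.act_mul g h hgh (σ (𝒢.s h))
  rw [fiberCast_apply_section, hφ, hφ h, map_smul, fiberCast_apply_section, map_smul, hφ g,
    map_smul, map_smul, fiberCast_apply_section, smul_smul] at h1
  have h2 := smul_left_injective ℝ (hσ _) h1
  exact Units.ext (h2.trans (mul_comm _ _))

omit [VectorBundle ℝ ℝ L] in
theorem IsCharFun.eq {σ : Cₛ^∞⟮𝓘(ℝ, EM); ℝ, L⟯} (hσ : ∀ x, σ x ≠ 0) {φ φ' : 𝒢.Cochain}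
    (hφ : Δ.IsCharFun σ φ) (hφ' : Δ.IsCharFun σ φ') : φ = φ' := by
  refine ContMDiffMap.ext fun g => Units.ext ?_
  exact smul_left_injective ℝ (hσ (𝒢.t g)) ((hφ g).symm.trans (hφ' g))

/-- The induced representation of the Lie algebroid on a nonvanishing section is given by the van
Est image of its characteristic function. -/
theorem IsCharFun.nabla_eq [ContMDiffVectorBundle ∞ ℝ L 𝓘(ℝ, EM)]
    {σ : Cₛ^∞⟮𝓘(ℝ, EM); ℝ, L⟯} {φ : 𝒢.Cochain} (hφ : Δ.IsCharFun σ φ) (hc : φ ∈ 𝒢.cocycles)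
    (x : M) (a : 𝒢.A x) : Δ.nabla σ x a = 𝒢.vanEst φ x a • σ x := by
  set e := trivializationAt ℝ L x with he
  have hx : x ∈ e.baseSet := mem_baseSet_trivializationAt ℝ L x
  set k : M → ℝ := fun y => (e ⟨y, σ y⟩).2 with hk
  have hkd : MDifferentiableAt 𝓘(ℝ, EM) 𝓘(ℝ, ℝ) k x :=
    (contMDiffAt_totalSpace.1 (σ.contMDiff x)).2.mdifferentiableAt (by simp)
  have hkt : MDifferentiableAt 𝓘(ℝ, EG) 𝓘(ℝ, ℝ) (fun g => k (𝒢.t g)) (𝒢.one x) :=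
    MDifferentiableAt.comp (g := k) (𝒢.one x) (by rw [𝒢.t_one]; exact hkd)
      (𝒢.t.contMDiff.mdifferentiableAt (by simp))
  have hφd : MDifferentiableAt 𝓘(ℝ, EG) 𝓘(ℝ, ℝ) (fun g => (φ g : ℝ)) (𝒢.one x) :=
    (Units.contMDiff_val.comp φ.contMDiff).mdifferentiableAt (n := ∞) (by simp)
  have hφ1 : (φ (𝒢.one x) : ℝ) = 1 := by rw [𝒢.cocycle_one hc]; rfl
  -- The logarithm has derivative 1 at `φ (one x) = 1`, so dφ and d log|φ| agree there.
  have hlog : 𝒢.vanEst φ x a =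
      dirDeriv (fun g => (φ g : ℝ)) (𝒢.one x) (a : TangentSpace 𝓘(ℝ, EG) (𝒢.one x)) := by
    rw [𝒢.vanEst_apply_of_mem_cocycles hc]
    have h1 := (Real.hasDerivAt_log (φ (𝒢.one x)).ne_zero).hasFDerivAt.hasMFDerivAt.comp (𝒢.one x)
      hφd.hasMFDerivAt
    refine (DFunLike.congr_fun h1.mfderiv _).trans ?_
    change dirDeriv (fun g => (φ g : ℝ)) (𝒢.one x) (a : TangentSpace 𝓘(ℝ, EG) (𝒢.one x)) *
      (φ (𝒢.one x) : ℝ)⁻¹ = _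
    rw [hφ1, inv_one, mul_one]
  have hev : (fun g => (e (⟨𝒢.t g, Δ.act g (σ (𝒢.s g))⟩ : TotalSpace ℝ L)).2) =ᶠ[𝓝 (𝒢.one x)]
      fun g => (φ g : ℝ) * k (𝒢.t g) := by
    have h1 : ∀ᶠ g in 𝓝 (𝒢.one x), 𝒢.t g ∈ e.baseSet :=
      𝒢.t.contMDiff.continuous.continuousAt.eventually_mem
        (e.open_baseSet.mem_nhds (by rw [𝒢.t_one]; exact hx))
    filter_upwards [h1] with g hg
    rw [hφ g]
    exact (e.continuousLinearEquivAt ℝ _ hg).map_smul _ _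
  have hder : dirDeriv (fun g => (e (⟨𝒢.t g, Δ.act g (σ (𝒢.s g))⟩ : TotalSpace ℝ L)).2) (𝒢.one x)
      (a : TangentSpace 𝓘(ℝ, EG) (𝒢.one x)) = 𝒢.vanEst φ x a * k x := by
    have h1 := (hφd.hasMFDerivAt.mul hkt.hasMFDerivAt).mfderiv
    have h2 := hev.mfderiv_eq (I := 𝓘(ℝ, EG)) (I' := 𝓘(ℝ, ℝ))
    refine (DFunLike.congr_fun (h2.trans h1) _).trans ?_
    change (φ (𝒢.one x) : ℝ) * dirDeriv (fun g => k (𝒢.t g)) (𝒢.one x)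
        (a : TangentSpace 𝓘(ℝ, EG) (𝒢.one x)) + k (𝒢.t (𝒢.one x)) *
        dirDeriv (fun g => (φ g : ℝ)) (𝒢.one x) (a : TangentSpace 𝓘(ℝ, EG) (𝒢.one x)) = _
    rw [𝒢.dirDeriv_comp_t hkd, hlog, 𝒢.t_one]
    ring
  have h3 : Δ.nabla σ x a = e.symm x (𝒢.vanEst φ x a * k x) := congrArg (e.symm x) hder
  have h4 : 𝒢.vanEst φ x a * k x = (e ⟨x, 𝒢.vanEst φ x a • σ x⟩).2 :=
    ((e.continuousLinearEquivAt ℝ x hx).map_smul _ _).symm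
  rw [h3, h4]
  exact e.symm_apply_apply_mk hx _

omit [VectorBundle ℝ ℝ L] in
theorem IsCharForm.eq {σ : Cₛ^∞⟮𝓘(ℝ, EM); ℝ, L⟯} (hσ : ∀ x, σ x ≠ 0) {θ θ' : 𝒢.Form}
    (hθ : Δ.IsCharForm σ θ) (hθ' : Δ.IsCharForm σ θ') : θ = θ' :=
  funext fun x => LinearMap.ext fun a =>
    smul_left_injective ℝ (hσ x) ((hθ x a).symm.trans (hθ' x a))

/-- The class of the characteristic function does not depend on the nonvanishing section. -/
theorem IsCharFun.mk_eq [ContMDiffVectorBundle ∞ ℝ L 𝓘(ℝ, EM)]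
    {σ τ : Cₛ^∞⟮𝓘(ℝ, EM); ℝ, L⟯} (hσ : ∀ x, σ x ≠ 0) (hτ : ∀ x, τ x ≠ 0) {φ ψ : 𝒢.cocycles}
    (hφ : Δ.IsCharFun σ φ.1) (hψ : Δ.IsCharFun τ ψ.1) :
    LieGroupoid.H1.mk 𝒢 φ = LieGroupoid.H1.mk 𝒢 ψ := by
  -- With τ = fσ, comparing coefficients of σ(t g) in Δ_g τ(s g) gives f(s g) φ(g) = ψ(g) f(t g), so
  -- φ⁻¹ψ = δf.
  obtain ⟨f, hf⟩ := exists_contMDiff_units_smul_eq τ.contMDiff σ.contMDiff hτ hσ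
  refine QuotientGroup.eq.2 ⟨f, fun g => Units.ext ?_⟩
  have h1 := hψ g
  rw [hf, hf (𝒢.t g), map_smul, hφ g, smul_smul, smul_smul] at h1
  have h2 : (f (𝒢.s g) : ℝ) * φ.1 g = ψ.1 g * f (𝒢.t g) := smul_left_injective ℝ (hσ _) h1
  have h3 : f (𝒢.s g) * φ.1 g = ψ.1 g * f (𝒢.t g) := Units.ext h2
  refine congrArg Units.val (?_ : (φ.1 g)⁻¹ * ψ.1 g = f (𝒢.s g) / f (𝒢.t g))
  rw [eq_div_iff_mul_eq', mul_assoc, ← h3, mul_left_comm, inv_mul_cancel, mul_one]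

end LineBundleRep
end LineBundles
end

/-! ### Assembly of the theorem -/

theorem mainTheorem4
    {EM : Type*} [NormedAddCommGroup EM] [NormedSpace ℝ EM] [FiniteDimensional ℝ EM]
    {M : Type*} [TopologicalSpace M] [ChartedSpace EM M] [IsManifold 𝓘(ℝ, EM) ∞ M]
    [T2Space M] [SecondCountableTopology M]
    {EG : Type*} [NormedAddCommGroup EG] [NormedSpace ℝ EG] [FiniteDimensional ℝ EG]
    {G : Type*} [TopologicalSpace G] [ChartedSpace EG G] [IsManifold 𝓘(ℝ, EG) ∞ G]
    (𝒢 : LieGroupoid EM M EG G)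
    (L : M → Type*) [∀ x, AddCommGroup (L x)] [∀ x, Module ℝ (L x)]
    [∀ x, TopologicalSpace (L x)] [TopologicalSpace (TotalSpace ℝ L)] [FiberBundle ℝ L]
    [VectorBundle ℝ ℝ L] [ContMDiffVectorBundle ∞ ℝ L 𝓘(ℝ, EM)]
    (Δ : LineBundleRep L 𝒢)
    (hL : ∃ σ : Cₛ^∞⟮𝓘(ℝ, EM); ℝ, L⟯, ∀ x, σ x ≠ 0) :
    (∀ σ : Cₛ^∞⟮𝓘(ℝ, EM); ℝ, L⟯, (∀ x, σ x ≠ 0) →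
      ∃ (φ : 𝒢.cocycles) (θ : 𝒢.algCocycles),
        (∀ φ' : 𝒢.Cochain, Δ.IsCharFun σ φ' ↔ φ' = φ.1) ∧
        (∀ θ' : 𝒢.Form, Δ.IsCharForm σ θ' ↔ θ' = θ.1) ∧
        𝒢.vanEst φ.1 = θ.1) ∧
    (∃! F : Additive 𝒢.H1 →+ 𝒢.AlgH1, 𝒢.IsInducedByVanEst F) ∧
    (∃! Φ : 𝒢.H1, Δ.IsCharClass Φ) ∧
    (∃! Θ : 𝒢.AlgH1, Δ.IsAlgCharClass Θ) ∧
    ∀ (F : Additive 𝒢.H1 →+ 𝒢.AlgH1) (Φ : 𝒢.H1) (Θ : 𝒢.AlgH1),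
      𝒢.IsInducedByVanEst F → Δ.IsCharClass Φ → Δ.IsAlgCharClass Θ →
        F (Additive.ofMul Φ) = Θ := by
  have hchar : ∀ σ : Cₛ^∞⟮𝓘(ℝ, EM); ℝ, L⟯, (∀ x, σ x ≠ 0) →
      ∃ φ : 𝒢.cocycles, Δ.IsCharFun σ φ.1 ∧
        Δ.IsCharForm σ (⟨𝒢.vanEst φ.1, 𝒢.vanEst_mem_algCocycles φ.2⟩ : 𝒢.algCocycles).1 :=
    fun σ hσ => by
      obtain ⟨φ, hφ⟩ := Δ.exists_isCharFun σ hσ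
      exact ⟨φ, hφ, hφ.nabla_eq Δ φ.2⟩
  -- Both class predicates quantify over nonvanishing sections; one such section is needed to
  -- exclude vacuous truth and to pin the classes down.
  obtain ⟨σ₀, hσ₀⟩ := hL
  obtain ⟨φ₀, hφ₀, hθ₀⟩ := hchar σ₀ hσ₀
  have hcls : ∀ φ : 𝒢.cocycles, ∀ σ : Cₛ^∞⟮𝓘(ℝ, EM); ℝ, L⟯, (∀ x, σ x ≠ 0) →
      Δ.IsCharFun σ φ.1 → LieGroupoid.H1.mk 𝒢 φ = LieGroupoid.H1.mk 𝒢 φ₀ := fun φ σ hσ hφ =>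
    hφ.mk_eq Δ hσ hσ₀ hφ₀
  have hΦ : ∀ Φ, Δ.IsCharClass Φ → Φ = LieGroupoid.H1.mk 𝒢 φ₀ := fun Φ h => by
    obtain ⟨φ, hφ, rfl⟩ := h σ₀ hσ₀
    exact hcls φ σ₀ hσ₀ hφ
  have hΘ : ∀ Θ, Δ.IsAlgCharClass Θ →
      Θ = 𝒢.vanEstH1 (Additive.ofMul (LieGroupoid.H1.mk 𝒢 φ₀)) := fun Θ h => by
    obtain ⟨θ, hθ, rfl⟩ := h σ₀ hσ₀
    rw [𝒢.vanEstH1_mk]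
    exact congrArg (LieGroupoid.AlgH1.mk 𝒢) (Subtype.ext (hθ.eq Δ hσ₀ hθ₀))
  refine ⟨fun σ hσ => ?_, ⟨𝒢.vanEstH1, 𝒢.isInducedByVanEst_vanEstH1, fun F hF =>
    𝒢.eq_vanEstH1_of_isInducedByVanEst hF⟩, ⟨_, fun σ hσ => ?_, hΦ⟩, ⟨_, fun σ hσ => ?_, hΘ⟩, ?_⟩
  · obtain ⟨φ, hφ, hθ⟩ := hchar σ hσ
    refine ⟨φ, ⟨_, 𝒢.vanEst_mem_algCocycles φ.2⟩, fun φ' => ⟨fun h => h.eq Δ hσ hφ, ?_⟩,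
      fun θ' => ⟨fun h => h.eq Δ hσ hθ, ?_⟩, rfl⟩
    · rintro rfl
      exact hφ
    · rintro rfl
      exact hθ
  · obtain ⟨φ, hφ, -⟩ := hchar σ hσ
    exact ⟨φ, hφ, hcls φ σ hσ hφ⟩
  · obtain ⟨φ, hφ, hθ⟩ := hchar σ hσ
    refine ⟨_, hθ, ?_⟩
    -- The class of θ_σ is the image of that of φ_σ, so its independence of σ needs no separate
    -- computation.
    rw [← 𝒢.vanEstH1_mk, hcls φ σ hσ hφ]
  · intro F Φ Θ hF hΦ' hΘ'
    rw [𝒢.eq_vanEstH1_of_isInducedByVanEst hF, hΦ Φ hΦ', hΘ Θ hΘ']
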